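/- Let $l\ge 1$. All limits, infinite sums and infinite products below are taken coefficientwise in the ring of formal power series with integer coefficients in the commuting variables $Y_0,Y_1,\dots$; $x_1,x_2,\dots$; $z$; $t$; $r_0,\dots,r_{l-1}$; $s_1,\dots,s_{l-1}$. **Words.** Let $w=w_1\cdots w_n$ be a word over $\mathbb N=\{0,1,2,\dots\}$. A position $i$ is a *decrease* if $w_i=w_{i+1}=\cdots=w_j>w_{j+1}$ for some $i\le j\le n-1$, and an *increase* otherwise; it is a *record* if $w_i\ge w_j$ for all $j<i$. For variables $\xi_j,\eta_j,\zeta_j$ put $$\psi'(w)=\prod_{i\ \text{decrease}}\xi_{w_i}\ \prod_{\substack{i\ \text{increase}\\ \text{not a record}}}\eta_{w_i}\ \prod_{\substack{i\ \text{increase}\\ \text{and record}}}\zeta_{w_i},$$ and let $\eta\psi'(w)$ be the result of the substitution $\xi_j\leftarrow tY_{i-1}$, $\zeta_j\leftarrow r_0Y_i$, $\eta_j\leftarrow Y_i$ if $j=li$, and $\xi_j\leftarrow s_mY_i$, $\zeta_j\leftarrow r_ms_mY_i$, $\eta_j\leftarrow s_mY_i$ if $j=li+m$ with $1\le m\le l-1$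 (the letter $0$ is never at a decrease, so $\xi_0$ does not occur). Let $[0,N]^*$ be the set of all finite words (including the empty one) over $\{0,1,\dots,N\}$. Put $H(aY)=\prod_{i\ge0}(1-aY_i)^{-1}$ and $E(aY)=\prod_{i\ge0}(1+aY_i)$. Then $$\lim_{N\to\infty}\sum_{w\in[0,N]^*}\eta\psi'(w)=\frac{H(r_0Y)(1-t)\prod_{m=1}^{l-1}E(-s_mY)H(r_ms_mY)}{\bigl(1+\sum_{m=1}^{l-1}s_m\bigr)H(tY)-\bigl(t+\sum_{m=1}^{l-1}s_m\bigr)H(Y)},$$ where every sum on the left converges and the denominator is invertible. **Colored permutations.** For $S\subseteq[n-1]$ let $F_{n,S}=\sum x_{i_1}\cdots x_{i_n}$ over $i_1\ge\cdots\ge i_n\ge1$ with $i_j>i_{j+1}$ for $j\in S$, and put $h_n=F_{n,\emptyset}$, $e_n=F_{n,[n-1]}$, $H(az)=\sum_{n\ge0}h_n(az)^n$, $E(az)=\sum_{n\ge0}e_n(az)^n$. A colored permutation $\pi\in C_l\wr\mathfrak S_n$ is a word $\pi_1\cdots\pi_n$ with $\pi_j=\sigma(j)^{\epsilon_j}$,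 $\sigma\in\mathfrak S_n$, $\epsilon_j\in\{0,\dots,l-1\}$; letters are ordered by $a^c<b^d$ iff $c>d$, or $c=d$ and $a<b$. A position $j$ is an excedance if $\pi_j>j^0$; $\operatorname{exc}(\pi)$ is the number of excedances; $\vec{\operatorname{fix}}(\pi)=(\operatorname{fix}_0,\dots,\operatorname{fix}_{l-1})$ with $\operatorname{fix}_m=|\{j:\pi_j=j^m\}|$; $\vec{\operatorname{col}}(\pi)=(\operatorname{col}_1,\dots,\operatorname{col}_{l-1})$ with $\operatorname{col}_m=|\{j:\epsilon_j=m\}|$. $\operatorname{DEX}(\pi)$ is the descent set of the word obtained from $\pi$ by marking the letters at excedances, where all marked letters are smaller than all unmarked ones and the order is otherwise unchanged. For $\vec\alpha\in\mathbb N^l$, $\vec\beta\in\mathbb N^{l-1}$ let $Q_{n,k,\vec\alpha,\vec\beta}=\sum_\pi F_{n,\operatorname{DEX}(\pi)}$ over all $\pi\in C_l\wr\mathfrak S_n$ with $\operatorname{exc}(\pi)=k$, $\vec{\operatorname{fix}}(\pi)=\vec\alpha$, $\vec{\operatorname{col}}(\pi)=\vec\beta$. Then (Hyatt's formula) $$\sum_{n,k\ge0,\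 \vec\alpha\in\mathbb N^l,\ \vec\beta\in\mathbb N^{l-1}}Q_{n,k,\vec\alpha,\vec\beta}\,z^nt^k\prod_{m=0}^{l-1}r_m^{\alpha_m}\prod_{m=1}^{l-1}s_m^{\beta_m}=\frac{H(r_0z)(1-t)\prod_{m=1}^{l-1}E(-s_mz)H(r_ms_mz)}{\bigl(1+\sum_{m=1}^{l-1}s_m\bigr)H(tz)-\bigl(t+\sum_{m=1}^{l-1}s_m\bigr)H(z)},$$ where the sum on the left converges and the denominator is invertible. -/

import Mathlib

open Filter Topology
open scoped MvPowerSeries.WithPiTopology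

namespace ColoredEulerian

/-! ### The ring of formal power series -/

/-- The commuting variables: the `Y i` (`i ≥ 0`) of the word weights, the `x i` (`i ≥ 1`) of the
quasisymmetric functions, `z`, `t`, the `r m` (`0 ≤ m ≤ l - 1`) and the `s m` (`1 ≤ m ≤ l - 1`).
Only the indices of these ranges are used below. -/
inductive Var : Type
  | Y (i : ℕ)
  | x (i : ℕ+)
  | z
  | t
  | r (m : ℕ)
  | s (m : ℕ)

/-- Formal power series with integer coefficients in all these variables. Limits, infinite sums
and infinite products are taken in the topology of coefficientwise convergence (`ℤ` is discrete),
which is the usual meaning of limits of formal power series. -/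
abbrev A : Type := MvPowerSeries Var ℤ

noncomputable section

abbrev Y (i : ℕ) : A := MvPowerSeries.X (Var.Y i)

abbrev x (i : ℕ+) : A := MvPowerSeries.X (Var.x i)

abbrev z : A := MvPowerSeries.X Var.z

abbrev t : A := MvPowerSeries.X Var.t

abbrev r (m : ℕ) : A := MvPowerSeries.X (Var.r m)

abbrev s (m : ℕ) : A := MvPowerSeries.X (Var.s m)

/-! ### Decrease values in words -/

section Words

variable {n : ℕ}

/-- `i` is a decrease of `w`: `w i = ⋯ = w j > w (j + 1)` for some `j ≥ i`. -/
def IsDecrease (w : Fin n → ℕ) (i : Fin n) : Prop :=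
  ∃ j j' : Fin n, i ≤ j ∧ (j' : ℕ) = j + 1 ∧ (∀ k, i ≤ k → k ≤ j → w k = w i) ∧ w j' < w j

/-- `i` is a record of `w`: `w i ≥ w j` for all `j < i`. -/
def IsRecord (w : Fin n → ℕ) (i : Fin n) : Prop :=
  ∀ j, j < i → w j ≤ w i

open Classical in
/-- The weight `ψ'(w)`: every decrease `i` contributes `ξ (w i)`, every increase (that is,
non-decrease) that is not a record contributes `η (w i)`, and every increase that is a record
contributes `ζ (w i)`. -/
def psi {R : Type*} [CommRing R] (ξ η ζ : ℕ → R) (w : Fin n → ℕ) : R :=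
  (∏ i ∈ Finset.univ.filter (fun i => IsDecrease w i), ξ (w i)) *
    (∏ i ∈ Finset.univ.filter (fun i => ¬ IsDecrease w i ∧ ¬ IsRecord w i), η (w i)) *
    ∏ i ∈ Finset.univ.filter (fun i => ¬ IsDecrease w i ∧ IsRecord w i), ζ (w i)

end Words

/-- The value substituted for `ξ j`: it is `t Y_{i-1}` if `j = l i` and `s_m Y_i` if
`j = l i + m` with `1 ≤ m ≤ l - 1`. The value for `j = 0` is never used, since the letter `0`
is never a decrease value; `Y_{-1}` is read as `0`. -/
def xiSub (l j : ℕ) : A :=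
  if j = 0 then 0
  else if j % l = 0 then t * Y (j / l - 1)
  else s (j % l) * Y (j / l)

/-- The value substituted for `η j`. -/
def etaSub (l j : ℕ) : A :=
  if j % l = 0 then Y (j / l) else s (j % l) * Y (j / l)

/-- The value substituted for `ζ j`. -/
def zetaSub (l j : ℕ) : A :=
  if j % l = 0 then r 0 * Y (j / l) else r (j % l) * s (j % l) * Y (j / l)

/-- The substituted weight `η ψ'(w)` of a word `w` over the alphabet `[0, N]`. -/
def wordWeight (l : ℕ) {N : ℕ} (w : List (Fin (N + 1))) : A :=
  psi (xiSub l) (etaSub l) (zetaSub l) (fun i : Fin w.length => ((w.get i : Fin (N + 1)) : ℕ))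

/-! ### The two sides `H` and `E`, in the alphabet `Y` -/

/-- `H(aY) = ∏_{i ≥ 0} (1 - a Y_i)⁻¹`. -/
def HY (a : A) : A := ∏' i : ℕ, Ring.inverse (1 - a * Y i)

/-- `E(aY) = ∏_{i ≥ 0} (1 + a Y_i)`. -/
def EY (a : A) : A := ∏' i : ℕ, (1 + a * Y i)

/-- The numerator `H(r₀)(1 - t) ∏_{m=1}^{l-1} E(-s_m) H(r_m s_m)`. -/
def numer (l : ℕ) (H E : A → A) : A :=
  H (r 0) * (1 - t) * ∏ m ∈ Finset.Ico 1 l, (E (-s m) * H (r m * s m))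

/-- The denominator `(1 + ∑_{m=1}^{l-1} s_m) H(t) - (t + ∑_{m=1}^{l-1} s_m) H(1)`. -/
def denom (l : ℕ) (H : A → A) : A :=
  (1 + ∑ m ∈ Finset.Ico 1 l, s m) * H t - (t + ∑ m ∈ Finset.Ico 1 l, s m) * H 1

/-! ### Quasisymmetric functions -/

/-- Gessel's fundamental quasisymmetric function `F_{n,S}`: the sum of `x_{i_1} ⋯ x_{i_n}` over
`i_1 ≥ ⋯ ≥ i_n ≥ 1` with `i_j > i_{j+1}` for `j ∈ S` (positions are numbered from `0` here). -/
def F (n : ℕ) (S : Set (Fin n)) : A :=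
  ∑' i : {i : Fin n → ℕ+ // Antitone i ∧ ∀ j j' : Fin n, (j' : ℕ) = j + 1 → j ∈ S → i j' < i j},
    ∏ j, x (i.1 j)

/-- The complete homogeneous symmetric function `h_n = F_{n,∅}`. -/
def h (n : ℕ) : A := F n ∅

/-- The elementary symmetric function `e_n = F_{n,[n-1]}`. -/
def e (n : ℕ) : A := F n Set.univ

/-- `H(az) = ∑_{n ≥ 0} h_n (az)^n`. -/
def Hz (a : A) : A := ∑' n : ℕ, h n * (a * z) ^ n

/-- `E(az) = ∑_{n ≥ 0} e_n (az)^n`. -/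
def Ez (a : A) : A := ∑' n : ℕ, e n * (a * z) ^ n

/-! ### Colored permutations -/

/-- The colored permutation group `C_l ≀ 𝔖_n` as a set of words: `π` has the letters
`π_j = (π.1 j)^{π.2 j}`, that is, absolute value `π.1 j` and color `π.2 j`. -/
abbrev ColPerm (l n : ℕ) : Type := Equiv.Perm (Fin n) × (Fin n → Fin l)

/-- The color order: `a^c < b^d` iff `c > d`, or `c = d` and `a < b`. -/
def colKey {n : ℕ} (c : ℕ) (a : Fin n) : ℕᵒᵈ ×ₗ Fin n := toLex (OrderDual.toDual c, a)

section ColPerm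

variable {l n : ℕ}

/-- `j` is an excedance of `π`: `π_j > j^0` in the color order. -/
def IsExc (π : ColPerm l n) (j : Fin n) : Prop := colKey 0 j < colKey (π.2 j) (π.1 j)

open Classical in
/-- The excedance number. -/
def exc (π : ColPerm l n) : ℕ := (Finset.univ.filter fun j => IsExc π j).card

open Classical in
/-- The fixed point vector `(fix_0, …, fix_{l-1})`, where `fix_m` counts the `j` with
`π_j = j^m`. -/
def fixVec (π : ColPerm l n) : Fin l → ℕ := fun m =>
  (Finset.univ.filter fun j => π.1 j = j ∧ π.2 j = m).card

open Classical in
/-- The color vector `(col_1, …, col_{l-1})`; the entry with index `m` is `col_{m+1}`. -/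
def colVec (π : ColPerm l n) : Fin (l - 1) → ℕ := fun m =>
  (Finset.univ.filter fun j => (π.2 j : ℕ) = m + 1).card

open Classical in
/-- The letter of `π` at `j`, marked by `0` if `j` is an excedance and by `1` otherwise.
Marked letters are ordered by putting all excedance letters below all other letters and keeping
the color order within each of the two classes. -/
def markedLetter (π : ColPerm l n) (j : Fin n) : ℕ ×ₗ (ℕᵒᵈ ×ₗ Fin n) :=
  toLex (if IsExc π j then 0 else 1, colKey (π.2 j) (π.1 j))

/-- `DEX π`, the descent set of the word of marked letters of `π`. -/
def DEX (π : ColPerm l n) : Set (Fin n) :=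
  {j | ∃ j' : Fin n, (j' : ℕ) = j + 1 ∧ markedLetter π j' < markedLetter π j}

end ColPerm

open Classical in
/-- The fixed point colored Eulerian quasisymmetric function `Q_{n,k,α,β}`. -/
def Q (l n k : ℕ) (α : Fin l → ℕ) (β : Fin (l - 1) → ℕ) : A :=
  ∑ π ∈ (Finset.univ : Finset (ColPerm l n)).filter
    (fun π => exc π = k ∧ fixVec π = α ∧ colVec π = β), F n (DEX π)

/-! ### The infinite sums and products above converge -/

theorem isUnit_one_sub (a : A) (i : ℕ) : IsUnit (1 - a * Y i) := by
  rw [MvPowerSeries.isUnit_iff_constantCoeff]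
  simp

theorem tendsto_weightedOrder_Y (f : ℕ → A) :
    Tendsto (fun i => MvPowerSeries.weightedOrder
      (fun v => match v with | Var.Y k => k | _ => 0) (f i * Y i)) atTop (𝓝 ⊤) := by
  rw [ENat.tendsto_nhds_top_iff_natCast_lt]
  intro n
  filter_upwards [eventually_gt_atTop n] with i hi
  refine lt_of_lt_of_le ?_ (MvPowerSeries.le_weightedOrder_mul _)
  have h1 : MvPowerSeries.weightedOrder
      (fun v => match v with | Var.Y k => k | _ => 0) (Y i) = (i : ℕ∞) := by
    have h2 : Y i = MvPowerSeries.monomial (Finsupp.single (Var.Y i) 1) (1 : ℤ) := rfl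
    rw [h2, MvPowerSeries.weightedOrder_monomial_of_ne_zero _ one_ne_zero]
    simp [Finsupp.weight_single]
  rw [h1]
  exact lt_of_lt_of_le (by exact_mod_cast hi) le_add_self

theorem multipliable_EY (a : A) : Multipliable fun i : ℕ => 1 + a * Y i :=
  MvPowerSeries.WithPiTopology.multipliable_one_add_of_tendsto_weightedOrder_atTop_nhds_top
    (tendsto_weightedOrder_Y fun _ => a)

theorem multipliable_HY (a : A) : Multipliable fun i : ℕ => Ring.inverse (1 - a * Y i) := by
  have key : (fun i : ℕ => Ring.inverse (1 - a * Y i)) =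
      fun i => 1 + (Ring.inverse (1 - a * Y i) * a) * Y i := by
    funext i
    have := Ring.inverse_mul_cancel _ (isUnit_one_sub a i)
    linear_combination this
  rw [key]
  exact MvPowerSeries.WithPiTopology.multipliable_one_add_of_tendsto_weightedOrder_atTop_nhds_top
    (tendsto_weightedOrder_Y fun i => Ring.inverse (1 - a * Y i) * a)

theorem summable_F (n : ℕ) (p : (Fin n → ℕ+) → Prop) :
    Summable fun i : {i : Fin n → ℕ+ // p i} => ∏ j, x (i.1 j) := by
  rw [MvPowerSeries.WithPiTopology.summable_iff_summable_coeff]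
  intro d
  apply summable_of_hasFiniteSupport
  have hfin : {i : Fin n → ℕ+ | ∀ j, Var.x (i j) ∈ d.support}.Finite := by
    have hinj : Function.Injective Var.x := fun a b hab => by cases hab; rfl
    have : {i : Fin n → ℕ+ | ∀ j, Var.x (i j) ∈ d.support} =
        {i : Fin n → ℕ+ | ∀ j, i j ∈ Var.x ⁻¹' (d.support : Set Var)} := rfl
    rw [this]
    exact Set.Finite.pi' fun _ => d.support.finite_toSet.preimage hinj.injOn
  refine (hfin.preimage Subtype.val_injective.injOn).subset ?_
  intro i hi j
  by_contra hj
  apply hi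
  change MvPowerSeries.coeff d (∏ j, x (i.1 j)) = 0
  classical
  rw [← Finset.mul_prod_erase _ _ (Finset.mem_univ j), MvPowerSeries.coeff_mul]
  refine Finset.sum_eq_zero fun q hq => ?_
  have hq' : q.1 + q.2 = d := by simpa using hq
  have : q.1 ≠ Finsupp.single (Var.x (i.1 j)) 1 := by
    rintro h1
    apply hj
    rw [← hq', h1]
    simp
  rw [MvPowerSeries.coeff_X, if_neg this, zero_mul]

theorem summable_z (f : ℕ → A) (a : A) : Summable fun n : ℕ => f n * (a * z) ^ n := by
  apply MvPowerSeries.WithPiTopology.summable_of_tendsto_order_atTop_nhds_top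
  rw [ENat.tendsto_nhds_top_iff_natCast_lt]
  intro n
  filter_upwards [eventually_gt_atTop n] with i hi
  have h1 : (1 : ℕ∞) ≤ (a * z).order :=
    MvPowerSeries.one_le_order_iff_constCoeff_eq_zero.mpr (by simp)
  have h2 : (i : ℕ∞) ≤ ((a * z) ^ i).order := by
    refine le_trans ?_ (MvPowerSeries.le_order_pow i)
    simpa using nsmul_le_nsmul_right h1 i
  exact lt_of_lt_of_le (lt_of_lt_of_le (by exact_mod_cast hi) h2)
    (le_trans le_add_self MvPowerSeries.le_order_mul)

end

end ColoredEulerian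

/-!
Words. A word with greatest letter `N` is cut in front of its first letter `N`. Behind this letter
the only records are further letters `N`, so the generating functions over `[0, N]` and
`[0, N - 1]` satisfy a first order recursion (`wordSum_recursion`) that is solved by a finite
product over a finite sum (`wordSum_mul_decreaseSum`). Under the substitution the product becomes
the numerator, the sum telescopes to the denominator at the cuts `N = l I` (`decreaseSum_sub`), and
since the increments tend to zero, this subsequence determines the limit (`tendsto_wordSum`).

Colored permutations. Expanding `F_{n, DEX π}` turns the left side into a sum over pairs of a
colored permutation `π` and an index sequence `i` that weakly decreases, such that the marked
letters of `π` increase within each block of equal indices (`IsCompatible`).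

* A fixed point of color `m` and index `b` can be inserted into such a pair in exactly one way up
  to the order of equal fixed points, so that multiplication by `1 - r_m s_m x_b z` removes
  the pairs that contain it (`one_sub_mul_pairSum`). Taking the product over all `b`, the fixed
  points split off as the factor `∏_m H(r_m s_m z)`, with `s_0 = 1` (`prod_Ez_mul_pairSum`). The
  case of the identity permutation gives `E(-az) H(az) = 1`. It remains to compute the sum `L` at
  `r_m = 1`.
* Writing index and class of the position `j` at the place `π_j`, a pair becomes a word from which
  it is recovered by sorting. The words that occur are described by conditions on the single
  letters relative to the sorted sequence `i` (`IsCompatible.isAdmissible`,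
  `exists_pairWord_eq`). Hence the coefficient of the content `c` in `L` is the coefficient of
  `X^c` in `∏_b B_b ^ (c_b - 1) (B_b - t X_b)`, with the linear forms
  `B_b = t ∑_{a ≥ b} X_a + ∑_{a ≤ b} X_a + (s_1 + ⋯ + s_{l-1}) ∑_a X_a`
  (`circuitSeriesAll_content`).
* Let `G_e` be the series with the coefficients of `X^c` in `∏_b B_b ^ (c_b - 1) (B_b - e X_b)`.
  Multiplication of a series of diagonal coefficients by `1 - e X_b` replaces one factor `B_b` by
  `B_b - e X_b`, so that `∏_b (1 - e X_b)⁻¹ G_e` does not depend on `e`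
  (`prod_one_sub_mul_circuitSeries`), while the products of the `B_b - X_b` and of the
  `B_b - t X_b` telescope against each other, which gives a linear relation between `G_1` and `G_t`
  (`circuitSeriesAll_relation`). The two relations determine `G_t`, that is `L`
  (`theta_mul_denom`).
-/

namespace ColoredEulerian

noncomputable section

/-! ### Coefficientwise convergence -/

theorem tendsto_iff_eventually_coeff {ι : Type*} {F : Filter ι} {u : ι → A} {a : A} :
    Tendsto u F (𝓝 a) ↔
      ∀ d, ∀ᶠ i in F, MvPowerSeries.coeff d (u i) = MvPowerSeries.coeff d a := by
  rw [MvPowerSeries.WithPiTopology.tendsto_iff_coeff_tendsto]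
  simp only [nhds_discrete, tendsto_pure]

theorem tendsto_mul_zero {ι : Type*} {F : Filter ι} {f : ι → A} (hf : Tendsto f F (𝓝 0))
    (g : ι → A) : Tendsto (fun i => g i * f i) F (𝓝 0) := by
  classical
  rw [tendsto_iff_eventually_coeff] at hf ⊢
  intro d
  have : ∀ᶠ i in F, ∀ p ∈ Finset.HasAntidiagonal.antidiagonal d,
      MvPowerSeries.coeff p.2 (f i) = 0 := by
    rw [eventually_all_finset]
    intro p _
    simpa using hf p.2
  filter_upwards [this] with i hi
  rw [MvPowerSeries.coeff_mul, map_zero]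
  exact Finset.sum_eq_zero fun p hp => by rw [hi p hp, mul_zero]

theorem tendsto_inverse {ι : Type*} {F : Filter ι} {u : ι → A} {a : A}
    (hu : Tendsto u F (𝓝 a)) (hui : ∀ i, IsUnit (u i)) (ha : IsUnit a) :
    Tendsto (fun i => Ring.inverse (u i)) F (𝓝 (Ring.inverse a)) := by
  have h1 : Tendsto (fun i => a - u i) F (𝓝 0) := by
    simpa using (tendsto_const_nhds (x := a)).sub hu
  have h2 := (tendsto_mul_zero h1 fun i => Ring.inverse (u i) * Ring.inverse a).add_const
    (Ring.inverse a)
  rw [zero_add] at h2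
  refine h2.congr fun i => ?_
  have e1 := Ring.inverse_mul_cancel _ (hui i)
  have e2 := Ring.inverse_mul_cancel _ ha
  linear_combination Ring.inverse (u i) * e2 - Ring.inverse a * e1

theorem summable_of_finite_coeff {ι : Type*} {f : ι → A}
    (hf : ∀ d, {i | MvPowerSeries.coeff d (f i) ≠ 0}.Finite) : Summable f := by
  rw [MvPowerSeries.WithPiTopology.summable_iff_summable_coeff]
  exact fun d => summable_of_hasFiniteSupport (hf d)

theorem coeff_tsum {ι : Type*} {f : ι → A} (hf : Summable f) (d : Var →₀ ℕ) :
    MvPowerSeries.coeff d (∑' i, f i) = ∑' i, MvPowerSeries.coeff d (f i) :=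
  ((MvPowerSeries.WithPiTopology.hasSum_iff_hasSum_coeff.mp hf.hasSum) d).tsum_eq.symm

theorem constantCoeff_hasProd {ι : Type*} {f : ι → A} {a : A} (hf : HasProd f a)
    (h1 : ∀ i, MvPowerSeries.constantCoeff (f i) = 1) : MvPowerSeries.constantCoeff a = 1 := by
  have h2 := hf.map (MvPowerSeries.constantCoeff (σ := Var) (R := ℤ))
    (MvPowerSeries.WithPiTopology.continuous_constantCoeff ℤ)
  have h3 : (MvPowerSeries.constantCoeff (σ := Var) (R := ℤ)) ∘ f = fun _ => 1 := funext h1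
  rw [h3] at h2
  exact h2.unique hasProd_one

theorem isUnit_of_constantCoeff {a : A} (h : MvPowerSeries.constantCoeff a = 1) : IsUnit a := by
  rw [MvPowerSeries.isUnit_iff_constantCoeff, h]; exact isUnit_one

theorem constantCoeff_denom {l : ℕ} {H : A → A}
    (hH : ∀ a, MvPowerSeries.constantCoeff (H a) = 1) :
    MvPowerSeries.constantCoeff (denom l H) = 1 := by
  simp [denom, hH]

/-! ### Weights of words as a recursion on lists -/

section Lists

/-- The first letter of `a :: w` is a decrease. -/
def IsDecHead (a : ℕ) : List ℕ → Prop
  | [] => False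
  | b :: w => b < a ∨ (b = a ∧ IsDecHead a w)

open Classical in
/-- The weight of a word that is read after a word with greatest letter `m`, so that a letter
counts as a record if it is also at least `m`. -/
def listWeight {R : Type*} [CommRing R] (ξ η ζ : ℕ → R) : ℕ → List ℕ → R
  | _, [] => 1
  | m, a :: w => (if IsDecHead a w then ξ a else if m ≤ a then ζ a else η a) *
      listWeight ξ η ζ (max m a) w

variable {R : Type*} [CommRing R] (ξ η ζ : ℕ → R)

theorem isDecrease_zero_cons (a : ℕ) (w : List ℕ) :
    IsDecrease (fun i : Fin (a :: w).length => (a :: w).get i) 0 ↔ IsDecHead a w := by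
  induction w with
  | nil =>
    simp only [IsDecHead, iff_false]
    rintro ⟨j, j', -, h, -⟩
    have := j'.2
    simp only [List.length_cons, List.length_nil] at this
    omega
  | cons b w ih =>
    simp only [IsDecHead]
    rw [← ih]
    constructor
    · rintro ⟨j, j', -, h1, h2, h3⟩
      obtain ⟨j, hj⟩ := j
      obtain ⟨j', hj'⟩ := j'
      simp only at h1
      subst h1
      cases j with
      | zero => left; simpa using h3
      | succ j =>
        right
        have hba : b = a := by
          simpa using h2 ⟨1, by simp⟩ (by simp) (by simp [Fin.le_def])
        subst hba
        refine ⟨rfl, ⟨j, by simpa using hj⟩, ⟨j + 1, by simpa using hj'⟩, by simp,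
          rfl, ?_, by simpa using h3⟩
        rintro ⟨k, hk⟩ - hkj
        cases k with
        | zero => rfl
        | succ k =>
          simpa using h2 ⟨k + 1 + 1, by simpa using hk⟩ (by simp)
            (by simpa [Fin.le_def] using hkj)
    · rintro (h | ⟨rfl, j, j', -, h1, h2, h3⟩)
      · refine ⟨0, ⟨1, by simp⟩, le_rfl, rfl, ?_, by simpa using h⟩
        rintro k - hk
        rw [Fin.le_zero_iff.mp hk]
      · obtain ⟨j, hj⟩ := j
        obtain ⟨j', hj'⟩ := j'
        simp only at h1
        subst h1
        refine ⟨⟨j + 1, by simpa using hj⟩, ⟨j + 2, by simpa using hj'⟩, by simp,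
          rfl, ?_, by simpa using h3⟩
        rintro ⟨k, hk⟩ - hkj
        cases k with
        | zero => rfl
        | succ k =>
          simpa using h2 ⟨k, by simpa using hk⟩ (by simp)
            (by simpa [Fin.le_def] using hkj)

theorem isDecrease_succ_cons (a : ℕ) (w : List ℕ) (i : Fin w.length) :
    IsDecrease (fun i : Fin (a :: w).length => (a :: w).get i) i.succ ↔
      IsDecrease (fun i : Fin w.length => w.get i) i := by
  constructor
  · rintro ⟨j, j', h0, h1, h2, h3⟩
    obtain ⟨j, rfl⟩ := Fin.exists_succ_eq.mpr
      (show j ≠ 0 from fun h => by rw [h] at h0; simp at h0)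
    obtain ⟨j', rfl⟩ := Fin.exists_succ_eq.mpr
      (show j' ≠ 0 from fun h => by rw [h] at h1; simp at h1)
    exact ⟨j, j', by simpa using h0, by simpa using h1,
      fun k hk hk' => by simpa using h2 k.succ (by simpa using hk) (by simpa using hk'),
      by simpa using h3⟩
  · rintro ⟨j, j', h0, h1, h2, h3⟩
    refine ⟨j.succ, j'.succ, by simpa using h0, by simpa using h1, ?_, by simpa using h3⟩
    intro k hk hk'
    obtain ⟨k, rfl⟩ := Fin.exists_succ_eq.mpr
      (show k ≠ 0 from fun h => by rw [h] at hk; simp at hk)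
    simpa using h2 k (by simpa using hk) (by simpa using hk')

open Classical in
theorem psi_eq_prod {n : ℕ} (w : Fin n → ℕ) :
    psi ξ η ζ w = ∏ i, if IsDecrease w i then ξ (w i) else
      if IsRecord w i then ζ (w i) else η (w i) := by
  rw [psi, Finset.prod_filter, Finset.prod_filter, Finset.prod_filter, ← Finset.prod_mul_distrib,
    ← Finset.prod_mul_distrib]
  refine Finset.prod_congr rfl fun i _ => ?_
  by_cases h1 : IsDecrease w i <;> by_cases h2 : IsRecord w i <;> simp [h1, h2]

open Classical in
theorem listWeight_eq_prod (m : ℕ) (w : List ℕ) :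
    listWeight ξ η ζ m w = ∏ i : Fin w.length,
      if IsDecrease (fun i : Fin w.length => w.get i) i then ξ (w.get i) else
        if m ≤ w.get i ∧ IsRecord (fun i : Fin w.length => w.get i) i then ζ (w.get i)
          else η (w.get i) := by
  induction w generalizing m with
  | nil => simp [listWeight]
  | cons a w ih =>
    rw [listWeight, ih]
    have h := Fin.prod_univ_succ (fun i : Fin (w.length + 1) =>
      if IsDecrease (fun i : Fin (a :: w).length => (a :: w).get i) i then ξ ((a :: w).get i) else
        if m ≤ (a :: w).get i ∧ IsRecord (fun i : Fin (a :: w).length => (a :: w).get i) i then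
          ζ ((a :: w).get i) else η ((a :: w).get i))
    refine Eq.trans ?_ h.symm
    congr 1
    · rw [isDecrease_zero_cons]
      have : IsRecord (fun i : Fin (a :: w).length => (a :: w).get i) 0 :=
        fun j hj => absurd hj (Fin.not_lt_zero j)
      simp only [this, and_true]
      rfl
    · refine Finset.prod_congr rfl fun i _ => ?_
      rw [isDecrease_succ_cons]
      have : (max m a ≤ w.get i ∧ IsRecord (fun i : Fin w.length => w.get i) i) ↔
          (m ≤ (a :: w).get i.succ ∧
            IsRecord (fun i : Fin (a :: w).length => (a :: w).get i) i.succ) := by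
        constructor
        · rintro ⟨h1, h2⟩
          refine ⟨(le_max_left _ _).trans h1, fun j => ?_⟩
          refine Fin.cases (fun _ => (le_max_right _ _).trans h1) (fun j hj => ?_) j
          exact h2 j (by simpa using hj)
        · rintro ⟨h1, h2⟩
          exact ⟨max_le h1 (h2 0 (Fin.succ_pos i)), fun j hj => h2 j.succ (by simpa using hj)⟩
      simp only [this]
      rfl

theorem psi_get_eq_listWeight (w : List ℕ) :
    psi ξ η ζ (fun i : Fin w.length => w.get i) = listWeight ξ η ζ 0 w := by
  classical
  rw [psi_eq_prod, listWeight_eq_prod]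
  simp only [Nat.zero_le, true_and]

/-- After a word with a letter greater than all letters of `w` no letter of `w` is a record. -/
theorem listWeight_of_lt {m : ℕ} {w : List ℕ} (h : ∀ b ∈ w, b < m) (m' : ℕ) :
    listWeight ξ η ζ m w = listWeight ξ η η m' w := by
  induction w generalizing m' with
  | nil => rfl
  | cons a w ih =>
    have ha : a < m := h a (by simp)
    simp only [listWeight, ite_self]
    rw [max_eq_left ha.le, ih (fun b hb => h b (by simp [hb])) (max m' a), if_neg (not_le.mpr ha)]

theorem isDecHead_append {a b : ℕ} {w v : List ℕ} (hw : ∀ c ∈ w, c < a) (hb : b < a) :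
    IsDecHead b (w ++ a :: v) ↔ IsDecHead b w := by
  induction w with
  | nil => simp only [List.nil_append, IsDecHead]; constructor
           · rintro (h | ⟨h, -⟩) <;> omega
           · exact False.elim
  | cons c w ih =>
    simp only [List.cons_append, IsDecHead]
    rw [ih fun c hc => hw c (by simp [hc])]

/-- A greater letter behind a word does not change the status of its letters, and after the
greatest letter `a` only further letters `a` are records. -/
theorem listWeight_append {a m : ℕ} {w : List ℕ} (hm : m ≤ a) (hw : ∀ c ∈ w, c < a)
    (v : List ℕ) : listWeight ξ η ζ m (w ++ a :: v) =
      listWeight ξ η ζ m w * listWeight ξ η ζ a (a :: v) := by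
  classical
  induction w generalizing m with
  | nil => simp [listWeight, hm]
  | cons c w ih =>
    have hc : c < a := hw c (by simp)
    have hw' : ∀ c ∈ w, c < a := fun c hc => hw c (by simp [hc])
    rw [List.cons_append, listWeight, listWeight, ih (max_le hm hc.le) hw']
    simp only [isDecHead_append hw' hc]
    ring

end Lists

/-! ### Generating functions of words over a finite alphabet -/

/-- The words over the alphabet `{0, …, N - 1}`. -/
def wordsBelow (N : ℕ) : Set (List ℕ) := {w | ∀ b ∈ w, b < N}

theorem summable_of_length_le_order {N : ℕ} {f : List ℕ → A} (h0 : ∀ w ∉ wordsBelow N, f w = 0)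
    (hf : ∀ w, (w.length : ℕ∞) ≤ (f w).order) : Summable f := by
  apply summable_of_finite_coeff
  intro d
  have hfin := (List.finite_length_le (Fin N) d.degree).image (List.map Fin.val)
  refine hfin.subset fun w hw => ?_
  have hwN : w ∈ wordsBelow N := by
    by_contra hc
    exact hw (by rw [h0 w hc, map_zero])
  refine ⟨w.attach.map fun b => ⟨b.1, hwN b.1 b.2⟩, ?_, ?_⟩
  · simp only [Set.mem_ofPred_eq, List.length_map, List.length_attach]
    by_contra hc
    exact hw (MvPowerSeries.coeff_of_lt_order (lt_of_lt_of_le (by exact_mod_cast not_le.mp hc)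
      (hf w)))
  · simp [List.map_map, Function.comp_def]

section Sums

variable {ξ η ζ : ℕ → A}

theorem length_le_order_listWeight (hξ : ∀ j, MvPowerSeries.constantCoeff (ξ j) = 0)
    (hη : ∀ j, MvPowerSeries.constantCoeff (η j) = 0)
    (hζ : ∀ j, MvPowerSeries.constantCoeff (ζ j) = 0) (m : ℕ) (w : List ℕ) :
    (w.length : ℕ∞) ≤ (listWeight ξ η ζ m w).order := by
  induction w generalizing m with
  | nil => simp
  | cons a w ih =>
    rw [listWeight, List.length_cons, add_comm]
    refine le_trans ?_ MvPowerSeries.le_order_mul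
    push_cast
    refine add_le_add ?_ (ih _)
    rw [MvPowerSeries.one_le_order_iff_constCoeff_eq_zero]
    split_ifs
    exacts [hξ a, hζ a, hη a]

variable (ξ η ζ) in
/-- The generating function of the words over `{0, …, N - 1}` that are read after a word with
greatest letter `m`. -/
def wordSum (N m : ℕ) : A := ∑' w, (wordsBelow N).indicator (listWeight ξ η ζ m) w

theorem summable_indicator (hξ : ∀ j, MvPowerSeries.constantCoeff (ξ j) = 0)
    (hη : ∀ j, MvPowerSeries.constantCoeff (η j) = 0)
    (hζ : ∀ j, MvPowerSeries.constantCoeff (ζ j) = 0) {N : ℕ} (m : ℕ) {S : Set (List ℕ)}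
    (hS : S ⊆ wordsBelow N) : Summable (S.indicator (listWeight ξ η ζ m)) := by
  refine summable_of_length_le_order (N := N)
    (fun w hw => Set.indicator_of_notMem (fun h => hw (hS h)) _) fun w => ?_
  by_cases hw : w ∈ S
  · rw [Set.indicator_of_mem hw]; exact length_le_order_listWeight hξ hη hζ m w
  · rw [Set.indicator_of_notMem hw]; simp

theorem wordSum_zero (m : ℕ) : wordSum ξ η ζ 0 m = 1 := by
  rw [wordSum, tsum_eq_single []]
  · rw [Set.indicator_of_mem (by simp [wordsBelow])]; rfl
  · intro w hw
    refine Set.indicator_of_notMem (fun h => ?_) _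
    obtain ⟨b, w, rfl⟩ := List.exists_cons_of_ne_nil hw
    simpa using h b (by simp)

theorem wordsBelow_succ_cons {N : ℕ} {w : List ℕ} :
    N :: w ∈ wordsBelow (N + 1) ↔ w ∈ wordsBelow (N + 1) := by
  simp [wordsBelow]

theorem wordsBelow_mono (N : ℕ) : wordsBelow N ⊆ wordsBelow (N + 1) :=
  fun _ h b hb => (h b hb).trans N.lt_succ_self

variable (ξ η ζ) in
/-- The generating function of the words over `{0, …, N}` that start with `N`. -/
def wordSumTop (N : ℕ) : A :=
  ∑' w, (wordsBelow (N + 1)).indicator (fun w => listWeight ξ η ζ N (N :: w)) w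

theorem summable_wordSumTop (hξ : ∀ j, MvPowerSeries.constantCoeff (ξ j) = 0)
    (hη : ∀ j, MvPowerSeries.constantCoeff (η j) = 0)
    (hζ : ∀ j, MvPowerSeries.constantCoeff (ζ j) = 0) (N : ℕ) :
    Summable ((wordsBelow (N + 1)).indicator (fun w => listWeight ξ η ζ N (N :: w))) := by
  have h1 := (summable_indicator hξ hη hζ (N := N + 1) N subset_rfl).comp_injective
    (List.cons_injective (a := N))
  refine h1.congr fun w => ?_
  by_cases hw : w ∈ wordsBelow (N + 1)
  · rw [Set.indicator_of_mem hw, Function.comp, Set.indicator_of_mem (wordsBelow_succ_cons.mpr hw)]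
  · rw [Set.indicator_of_notMem hw, Function.comp,
      Set.indicator_of_notMem (fun h => hw (wordsBelow_succ_cons.mp h))]

/-- A word over `{0, …, N}` either avoids `N` or is cut in front of its first letter `N`. -/
theorem wordSum_succ (hξ : ∀ j, MvPowerSeries.constantCoeff (ξ j) = 0)
    (hη : ∀ j, MvPowerSeries.constantCoeff (η j) = 0)
    (hζ : ∀ j, MvPowerSeries.constantCoeff (ζ j) = 0) {N m : ℕ} (hm : m ≤ N) :
    wordSum ξ η ζ (N + 1) m = wordSum ξ η ζ N m * (1 + wordSumTop ξ η ζ N) := by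
  have hdiff : wordsBelow (N + 1) \ wordsBelow N ⊆ wordsBelow (N + 1) := Set.sdiff_subset
  have hsplit : (wordsBelow (N + 1)).indicator (listWeight ξ η ζ m) =
      fun w => (wordsBelow N).indicator (listWeight ξ η ζ m) w +
        (wordsBelow (N + 1) \ wordsBelow N).indicator (listWeight ξ η ζ m) w := by
    funext w
    by_cases h1 : w ∈ wordsBelow N
    · have h2 := wordsBelow_mono N h1
      simp [Set.indicator, h1, h2]
    · rw [Set.indicator_of_notMem h1, zero_add]
      by_cases h2 : w ∈ wordsBelow (N + 1)
      · rw [Set.indicator_of_mem h2, Set.indicator_of_mem (Set.mem_sdiff _ |>.mpr ⟨h2, h1⟩)]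
      · rw [Set.indicator_of_notMem h2, Set.indicator_of_notMem fun h3 => h2 h3.1]
  rw [wordSum, hsplit, Summable.tsum_add (summable_indicator hξ hη hζ m subset_rfl)
    (summable_indicator hξ hη hζ m hdiff), mul_add, mul_one]
  congr 1
  let g : wordsBelow N × List ℕ → List ℕ := fun p => p.1.1 ++ N :: p.2
  have hN : ∀ w : wordsBelow N, N ∉ w.1 := fun w h => lt_irrefl N (w.2 N h)
  have hg : Function.Injective g := by
    rintro ⟨⟨w, hw⟩, v⟩ ⟨⟨w', hw'⟩, v'⟩ h
    suffices w = w' ∧ v = v' by obtain ⟨rfl, rfl⟩ := this; rfl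
    change w ++ N :: v = w' ++ N :: v' at h
    clear * - hw hw' h
    induction w generalizing w' with
    | nil =>
      cases w' with
      | nil => simpa using h
      | cons b w' =>
        simp only [List.nil_append, List.cons_append, List.cons.injEq] at h
        exact absurd (hw' b (by simp)) (by omega)
    | cons a w ih =>
      cases w' with
      | nil =>
        simp only [List.nil_append, List.cons_append, List.cons.injEq] at h
        exact absurd (hw a (by simp)) (by omega)
      | cons b w' =>
        simp only [List.cons_append, List.cons.injEq] at h
        obtain ⟨h1, h2⟩ := ih (fun c hc => hw c (by simp [hc])) w'
          (fun c hc => hw' c (by simp [hc])) h.2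
        exact ⟨by rw [h.1, h1], h2⟩
  have hval : ∀ p, (wordsBelow (N + 1) \ wordsBelow N).indicator (listWeight ξ η ζ m) (g p) =
      listWeight ξ η ζ m p.1.1 *
        (wordsBelow (N + 1)).indicator (fun w => listWeight ξ η ζ N (N :: w)) p.2 := by
    rintro ⟨w, v⟩
    by_cases hv : v ∈ wordsBelow (N + 1)
    · rw [Set.indicator_of_mem hv, Set.indicator_of_mem, listWeight_append ξ η ζ hm w.2]
      refine ⟨fun b hb => ?_, fun hc => lt_irrefl N (hc N (by simp [g]))⟩
      rcases List.mem_append.mp hb with hb | hb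
      · exact (w.2 b hb).trans N.lt_succ_self
      · exact wordsBelow_succ_cons.mpr hv b hb
    · rw [Set.indicator_of_notMem hv, Set.indicator_of_notMem, mul_zero]
      exact fun hc => hv fun b hb => hc.1 b (by simp [g, hb])
  have hsum : Summable fun w : wordsBelow N => listWeight ξ η ζ m w.1 := by
    have := summable_indicator hξ hη hζ m (subset_rfl (a := wordsBelow N))
    exact summable_subtype_iff_indicator.mpr this
  have hprod : Summable fun p : wordsBelow N × List ℕ => listWeight ξ η ζ m p.1.1 *
        (wordsBelow (N + 1)).indicator (fun w => listWeight ξ η ζ N (N :: w)) p.2 :=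
    ((summable_indicator hξ hη hζ m hdiff).comp_injective hg).congr fun p => hval p
  rw [wordSum, ← tsum_subtype (wordsBelow N), wordSumTop,
    hsum.tsum_mul_tsum (summable_wordSumTop hξ hη hζ N) hprod, ← hg.tsum_eq]
  · exact tsum_congr hval
  · intro w hw
    obtain ⟨h1, h2⟩ := Set.mem_of_indicator_ne_zero hw
    have hNw : N ∈ w := by
      by_contra hc
      refine h2 fun b hb => lt_of_le_of_ne (Nat.lt_succ_iff.mp (h1 b hb)) ?_
      rintro rfl
      exact hc hb
    obtain ⟨u, v, rfl, hu⟩ := List.eq_append_cons_of_mem hNw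
    refine ⟨⟨⟨u, fun b hb => ?_⟩, v⟩, rfl⟩
    refine lt_of_le_of_ne (Nat.lt_succ_iff.mp (h1 b (by simp [hb]))) ?_
    rintro rfl
    exact hu hb

/-- The generating function of the words that start with `N`. The words behind the first `N` are
split according to whether this `N` is a decrease; if it is not, the word is empty or starts with
a further `N`, which is again not a decrease. -/
theorem one_add_wordSumTop (hξ : ∀ j, MvPowerSeries.constantCoeff (ξ j) = 0)
    (hη : ∀ j, MvPowerSeries.constantCoeff (η j) = 0)
    (hζ : ∀ j, MvPowerSeries.constantCoeff (ζ j) = 0) (N : ℕ) :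
    (1 + wordSumTop ξ η ζ N) * (1 - ξ N * wordSum ξ η ζ N N) * (1 - ζ N) = 1 - ξ N := by
  set D : Set (List ℕ) := {w | w ∈ wordsBelow (N + 1) ∧ IsDecHead N w} with hD
  set I : Set (List ℕ) := {w | w ∈ wordsBelow (N + 1) ∧ ¬ IsDecHead N w} with hI
  have sD := summable_indicator hξ hη hζ (S := D) N fun w h => h.1
  have sI := summable_indicator hξ hη hζ (S := I) N fun w h => h.1
  have hU : wordSum ξ η ζ (N + 1) N = ∑' w, D.indicator (listWeight ξ η ζ N) w +
      ∑' w, I.indicator (listWeight ξ η ζ N) w := by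
    rw [wordSum, ← Summable.tsum_add sD sI]
    refine tsum_congr fun w => ?_
    by_cases h1 : w ∈ wordsBelow (N + 1) <;> by_cases h2 : IsDecHead N w <;>
      simp [Set.indicator, hD, hI, h1, h2]
  have hT : wordSumTop ξ η ζ N = ξ N * ∑' w, D.indicator (listWeight ξ η ζ N) w +
      ζ N * ∑' w, I.indicator (listWeight ξ η ζ N) w := by
    rw [wordSumTop, ← sD.tsum_mul_left, ← sI.tsum_mul_left,
      ← Summable.tsum_add (sD.mul_left _) (sI.mul_left _)]
    refine tsum_congr fun w => ?_
    by_cases h1 : w ∈ wordsBelow (N + 1) <;> by_cases h2 : IsDecHead N w <;>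
      simp [Set.indicator, hD, hI, h1, h2, listWeight]
  have hTI : ∑' w, I.indicator (listWeight ξ η ζ N) w =
      1 + ζ N * ∑' w, I.indicator (listWeight ξ η ζ N) w := by
    have hnil : ([] : List ℕ) ∈ I := ⟨by simp [wordsBelow], by simp [IsDecHead]⟩
    have hcons : ∀ v, N :: v ∈ I ↔ v ∈ I := fun v => by
      simp [hI, wordsBelow_succ_cons, IsDecHead]
    have hc : Summable ((List.cons N '' I).indicator (listWeight ξ η ζ N)) := by
      refine summable_indicator hξ hη hζ (N := N + 1) N ?_
      rintro _ ⟨v, hv, rfl⟩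
      exact wordsBelow_succ_cons.mpr hv.1
    have hn : Summable (({[]} : Set (List ℕ)).indicator (listWeight ξ η ζ N)) := by
      refine summable_indicator hξ hη hζ (N := N + 1) N ?_
      rintro _ rfl
      exact hnil.1
    have hIsplit : ∀ w, I.indicator (listWeight ξ η ζ N) w =
        ({[]} : Set (List ℕ)).indicator (listWeight ξ η ζ N) w +
          (List.cons N '' I).indicator (listWeight ξ η ζ N) w := by
      rintro (_ | ⟨b, v⟩)
      · simp [Set.indicator, hnil]
      · by_cases hb : b = N
        · subst hb
          by_cases hv : v ∈ I <;> simp [Set.indicator, hcons, hv]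
        · have : b :: v ∉ I := by
            rintro ⟨h1, h2⟩
            have := h1 b (by simp)
            exact h2 (Or.inl (by omega))
          simp [Set.indicator, this, Ne.symm hb]
    rw [← sI.tsum_mul_left, tsum_congr hIsplit, Summable.tsum_add hn hc]
    congr 1
    · rw [tsum_eq_single []]
      · simp [listWeight]
      · intro w hw
        simp [hw]
    · rw [← (List.cons_injective (a := N)).tsum_eq]
      · refine tsum_congr fun v => ?_
        by_cases hv : v ∈ I
        · simp [Set.indicator, hv, listWeight, hv.2]
        · simp [Set.indicator, hv]
      · intro w hw
        obtain ⟨v, -, rfl⟩ := Set.mem_of_indicator_ne_zero hw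
        exact ⟨v, rfl⟩
  have hrec := wordSum_succ hξ hη hζ (le_refl N)
  set TD := ∑' w, D.indicator (listWeight ξ η ζ N) w
  set TI := ∑' w, I.indicator (listWeight ξ η ζ N) w
  have h1 : 1 + wordSumTop ξ η ζ N = ξ N * TD + TI := by rw [hT]; linear_combination -hTI
  rw [hU, h1] at hrec
  rw [h1]
  linear_combination ((1 - ζ N) * ξ N) * hrec + (1 - ξ N) * hTI

/-- After a greater letter there are no records. -/
theorem wordSum_self (N : ℕ) : wordSum ξ η ζ N N = wordSum ξ η η N 0 := by
  refine tsum_congr fun w => ?_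
  by_cases hw : w ∈ wordsBelow N
  · rw [Set.indicator_of_mem hw, Set.indicator_of_mem hw, listWeight_of_lt ξ η ζ hw]
  · rw [Set.indicator_of_notMem hw, Set.indicator_of_notMem hw]

theorem wordSum_recursion (hξ : ∀ j, MvPowerSeries.constantCoeff (ξ j) = 0)
    (hη : ∀ j, MvPowerSeries.constantCoeff (η j) = 0)
    (hζ : ∀ j, MvPowerSeries.constantCoeff (ζ j) = 0) (N : ℕ) :
    wordSum ξ η ζ (N + 1) 0 * (1 - ζ N) * (1 - ξ N * wordSum ξ η η N 0) =
      wordSum ξ η ζ N 0 * (1 - ξ N) := by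
  have h1 := wordSum_succ hξ hη hζ (Nat.zero_le N)
  have h2 := one_add_wordSumTop hξ hη hζ N
  rw [wordSum_self] at h2
  rw [h1]
  linear_combination wordSum ξ η ζ N 0 * h2

variable (ξ η) in
/-- The sum `1 - ∑_{j < N} ξ_j ∏_{i < j} (1 - ξ_i) / (1 - η_i)`. -/
def decreaseSum (N : ℕ) : A :=
  1 - ∑ j ∈ Finset.range N, ξ j * ∏ i ∈ Finset.range j, ((1 - ξ i) * Ring.inverse (1 - η i))

theorem isUnit_one_sub_of {a : A} (ha : MvPowerSeries.constantCoeff a = 0) : IsUnit (1 - a) :=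
  isUnit_of_constantCoeff (by simp [ha])

theorem wordSum_mul_decreaseSum (hξ : ∀ j, MvPowerSeries.constantCoeff (ξ j) = 0)
    (hη : ∀ j, MvPowerSeries.constantCoeff (η j) = 0)
    (hζ : ∀ j, MvPowerSeries.constantCoeff (ζ j) = 0) (N : ℕ) :
    wordSum ξ η ζ N 0 * (∏ j ∈ Finset.range N, (1 - ζ j)) * decreaseSum ξ η N =
      ∏ j ∈ Finset.range N, (1 - ξ j) := by
  have hstep : ∀ N, decreaseSum ξ η (N + 1) = decreaseSum ξ η N -
      ξ N * ∏ i ∈ Finset.range N, ((1 - ξ i) * Ring.inverse (1 - η i)) := fun N => by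
    rw [decreaseSum, decreaseSum, Finset.sum_range_succ]; ring
  have hprod : ∀ N, (∏ i ∈ Finset.range N, ((1 - ξ i) * Ring.inverse (1 - η i))) *
      ∏ j ∈ Finset.range N, (1 - η j) = ∏ j ∈ Finset.range N, (1 - ξ j) := fun N => by
    rw [← Finset.prod_mul_distrib]
    refine Finset.prod_congr rfl fun j _ => ?_
    rw [mul_assoc, Ring.inverse_mul_cancel _ (isUnit_one_sub_of (hη j)), mul_one]
  have hunit : ∀ N, IsUnit (1 - ξ N * wordSum ξ η η N 0) := fun N =>
    isUnit_one_sub_of (by simp [hξ])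
  have hW : ∀ N, wordSum ξ η η N 0 * (∏ j ∈ Finset.range N, (1 - η j)) * decreaseSum ξ η N =
      ∏ j ∈ Finset.range N, (1 - ξ j) := by
    intro N
    induction N with
    | zero => simp [wordSum_zero, decreaseSum]
    | succ N ih =>
      refine (hunit N).mul_left_injective ?_
      simp only
      rw [Finset.prod_range_succ, Finset.prod_range_succ, hstep]
      have h1 := wordSum_recursion hξ hη hη N
      have h2 := hprod N
      set P := ∏ i ∈ Finset.range N, ((1 - ξ i) * Ring.inverse (1 - η i))
      linear_combination (decreaseSum ξ η N - ξ N * P) * (∏ j ∈ Finset.range N, (1 - η j)) * h1 +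
        (1 - ξ N) * ih - wordSum ξ η η N 0 * (1 - ξ N) * ξ N * h2
  induction N with
  | zero => simp [wordSum_zero, decreaseSum]
  | succ N ih =>
    -- `h4` below says that replacing `η` by `ζ` in the weights of the records multiplies the
    -- generating function by `∏ (1 - η_j) / (1 - ζ_j)`
    refine (hunit N).mul_left_injective ?_
    simp only
    have hE : IsUnit ((∏ j ∈ Finset.range N, (1 - η j)) * decreaseSum ξ η N) := by
      have h1 : IsUnit (∏ j ∈ Finset.range N, (1 - ξ j)) :=
        isUnit_of_constantCoeff (by simp [map_prod, hξ])
      rw [← hW N, mul_assoc] at h1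
      exact isUnit_of_mul_isUnit_right h1
    rw [Finset.prod_range_succ, Finset.prod_range_succ, hstep]
    have h1 := wordSum_recursion hξ hη hζ N
    have h2 := hprod N
    have h3 := hW N
    set P := ∏ i ∈ Finset.range N, ((1 - ξ i) * Ring.inverse (1 - η i))
    have h4 : wordSum ξ η ζ N 0 * (∏ j ∈ Finset.range N, (1 - ζ j)) * P =
        wordSum ξ η η N 0 * ∏ j ∈ Finset.range N, (1 - ξ j) := by
      refine hE.mul_left_injective ?_
      simp only
      linear_combination (P * ∏ j ∈ Finset.range N, (1 - η j)) * ih +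
        (∏ j ∈ Finset.range N, (1 - ξ j)) * (h2 - h3)
    linear_combination (∏ j ∈ Finset.range N, (1 - ζ j)) * (decreaseSum ξ η N - ξ N * P) * h1 +
      (1 - ξ N) * ih - ξ N * (1 - ξ N) * h4

end Sums

/-! ### The limit for words -/

section Substitution

variable {l : ℕ}

theorem constantCoeff_xiSub (j : ℕ) : MvPowerSeries.constantCoeff (xiSub l j) = 0 := by
  unfold xiSub; split_ifs <;> simp

theorem constantCoeff_etaSub (j : ℕ) : MvPowerSeries.constantCoeff (etaSub l j) = 0 := by
  unfold etaSub; split_ifs <;> simp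

theorem constantCoeff_zetaSub (j : ℕ) : MvPowerSeries.constantCoeff (zetaSub l j) = 0 := by
  unfold zetaSub; split_ifs <;> simp

theorem wordWeight_eq {N : ℕ} (w : List (Fin (N + 1))) :
    wordWeight l w = listWeight (xiSub l) (etaSub l) (zetaSub l) 0 (w.map Fin.val) := by
  rw [← psi_get_eq_listWeight, wordWeight]
  have key : ∀ {n n' : ℕ} (e : n' = n) (f : Fin n → ℕ) (g : Fin n' → ℕ)
      (_ : ∀ i, g i = f (Fin.cast e i)),
      psi (xiSub l) (etaSub l) (zetaSub l) f = psi (xiSub l) (etaSub l) (zetaSub l) g := by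
    rintro n _ rfl f g h
    congr 1
    exact (funext h).symm
  exact key (List.length_map _) _ _ fun i => by simp

theorem range_map_val (N : ℕ) :
    Set.range (List.map (Fin.val : Fin (N + 1) → ℕ)) = wordsBelow (N + 1) := by
  ext w
  constructor
  · rintro ⟨w, rfl⟩ b hb
    obtain ⟨c, -, rfl⟩ := List.mem_map.mp hb
    exact c.2
  · intro hw
    exact ⟨w.attach.map fun b => ⟨b.1, hw b.1 b.2⟩, by simp [List.map_map, Function.comp_def]⟩

theorem hasSum_wordWeight (N : ℕ) : HasSum (fun w : List (Fin (N + 1)) => wordWeight l w)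
    (wordSum (xiSub l) (etaSub l) (zetaSub l) (N + 1) 0) := by
  have h1 := (summable_indicator (constantCoeff_xiSub (l := l)) (constantCoeff_etaSub (l := l))
    (constantCoeff_zetaSub (l := l)) (N := N + 1) 0 subset_rfl).hasSum
  have hinj : Function.Injective (List.map (Fin.val : Fin (N + 1) → ℕ)) :=
    List.map_injective_iff.mpr Fin.val_injective
  rw [← hinj.hasSum_iff] at h1
  · refine (funext fun w => ?_ : (fun w : List (Fin (N + 1)) => wordWeight l w) = _) ▸ h1
    rw [Function.comp, Set.indicator_of_mem, wordWeight_eq]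
    rw [← range_map_val]
    exact ⟨w, rfl⟩
  · intro w hw
    rw [range_map_val] at hw
    exact Set.indicator_of_notMem hw _

/-- The partial products of `H(aY)`. -/
def HPart (I : ℕ) (a : A) : A := ∏ i ∈ Finset.range I, Ring.inverse (1 - a * Y i)

/-- The partial products of `E(aY)`. -/
def EPart (I : ℕ) (a : A) : A := ∏ i ∈ Finset.range I, (1 + a * Y i)

theorem EPart_neg_mul_HPart (I : ℕ) (a : A) : EPart I (-a) * HPart I a = 1 := by
  rw [EPart, HPart, ← Finset.prod_mul_distrib]
  refine Finset.prod_eq_one fun i _ => ?_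
  rw [neg_mul, ← sub_eq_add_neg, Ring.mul_inverse_cancel _ (isUnit_one_sub a i)]

theorem constantCoeff_HPart (I : ℕ) (a : A) :
    MvPowerSeries.constantCoeff (HPart I a) = 1 := by
  have h1 := congrArg MvPowerSeries.constantCoeff (EPart_neg_mul_HPart I a)
  have h2 : MvPowerSeries.constantCoeff (EPart I (-a)) = 1 := by
    simp [EPart, map_prod]
  rwa [map_mul, h2, one_mul, map_one] at h1

theorem tendsto_HPart (a : A) : Tendsto (fun I => HPart I a) atTop (𝓝 (HY a)) :=
  (multipliable_HY a).hasProd.tendsto_prod_nat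

theorem tendsto_EPart (a : A) : Tendsto (fun I => EPart I a) atTop (𝓝 (EY a)) :=
  (multipliable_EY a).hasProd.tendsto_prod_nat

theorem constantCoeff_HY (a : A) : MvPowerSeries.constantCoeff (HY a) = 1 := by
  refine constantCoeff_hasProd (multipliable_HY a).hasProd fun i => ?_
  have h1 := congrArg MvPowerSeries.constantCoeff
    (Ring.inverse_mul_cancel _ (isUnit_one_sub a i))
  simpa using h1

theorem xiSub_mul_add {m : ℕ} (hm : m ∈ Finset.Ico 1 l) (I : ℕ) :
    xiSub l (l * I + m) = s m * Y I := by
  obtain ⟨h1, h2⟩ := Finset.mem_Ico.mp hm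
  have h3 : (l * I + m) % l = m := by rw [Nat.mul_add_mod, Nat.mod_eq_of_lt h2]
  have h4 : (l * I + m) / l = I := by
    rw [Nat.mul_add_div (by omega), Nat.div_eq_of_lt h2, add_zero]
  rw [xiSub, h3, h4, if_neg (by omega), if_neg (by omega)]

theorem xiSub_mul_succ (hl : 0 < l) (I : ℕ) : xiSub l (l * (I + 1)) = t * Y I := by
  rw [xiSub, if_neg (by positivity), if_pos (Nat.mul_mod_right _ _), Nat.mul_div_cancel_left _ hl,
    Nat.add_sub_cancel]

theorem etaSub_mul_add {m : ℕ} (hm : m ∈ Finset.Ico 1 l) (I : ℕ) :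
    etaSub l (l * I + m) = s m * Y I := by
  obtain ⟨h1, h2⟩ := Finset.mem_Ico.mp hm
  have h3 : (l * I + m) % l = m := by rw [Nat.mul_add_mod, Nat.mod_eq_of_lt h2]
  have h4 : (l * I + m) / l = I := by
    rw [Nat.mul_add_div (by omega), Nat.div_eq_of_lt h2, add_zero]
  rw [etaSub, h3, h4, if_neg (by omega)]

theorem etaSub_mul (hl : 0 < l) (I : ℕ) : etaSub l (l * I) = Y I := by
  rw [etaSub, if_pos (Nat.mul_mod_right _ _), Nat.mul_div_cancel_left _ hl]

theorem zetaSub_mul_add {m : ℕ} (hm : m ∈ Finset.Ico 1 l) (I : ℕ) :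
    zetaSub l (l * I + m) = r m * s m * Y I := by
  obtain ⟨h1, h2⟩ := Finset.mem_Ico.mp hm
  have h3 : (l * I + m) % l = m := by rw [Nat.mul_add_mod, Nat.mod_eq_of_lt h2]
  have h4 : (l * I + m) / l = I := by
    rw [Nat.mul_add_div (by omega), Nat.div_eq_of_lt h2, add_zero]
  rw [zetaSub, h3, h4, if_neg (by omega)]

theorem zetaSub_mul (hl : 0 < l) (I : ℕ) : zetaSub l (l * I) = r 0 * Y I := by
  rw [zetaSub, if_pos (Nat.mul_mod_right _ _), Nat.mul_div_cancel_left _ hl]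

/-- The letters `l I + 1, …, l (I + 1)` are the `l I + m` with `1 ≤ m < l` and `l (I + 1)`. -/
theorem prod_range_block {M : Type*} [CommMonoid M] (hl : 0 < l) (f : ℕ → M) (I : ℕ) :
    ∏ k ∈ Finset.range l, f (l * I + 1 + k) =
      (∏ m ∈ Finset.Ico 1 l, f (l * I + m)) * f (l * (I + 1)) := by
  obtain ⟨l, rfl⟩ := Nat.exists_eq_add_of_lt hl
  rw [zero_add, Finset.prod_range_succ, Finset.prod_Ico_eq_prod_range, Nat.add_sub_cancel]
  congr 1
  · exact Finset.prod_congr rfl fun k _ => by rw [add_assoc]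
  · exact congrArg f (by ring)

theorem sum_range_block {M : Type*} [AddCommMonoid M] (hl : 0 < l) (f : ℕ → M) (I : ℕ) :
    ∑ k ∈ Finset.range l, f (l * I + 1 + k) =
      (∑ m ∈ Finset.Ico 1 l, f (l * I + m)) + f (l * (I + 1)) :=
  prod_range_block (M := Multiplicative M) hl (fun k => Multiplicative.ofAdd (f k)) I

theorem EPart_succ (I : ℕ) (a : A) : EPart (I + 1) a = EPart I a * (1 + a * Y I) :=
  Finset.prod_range_succ _ _

theorem HPart_succ (I : ℕ) (a : A) : HPart (I + 1) a = HPart I a * Ring.inverse (1 - a * Y I) :=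
  Finset.prod_range_succ _ _

/-- The product of the factors for the letters `0, …, l I`. The letter `l (i + 1)` carries `Y i`
in `ξ`, which is why the alphabet is cut behind the letter `l I`. -/
theorem prod_one_sub_xiSub (hl : 0 < l) (I : ℕ) :
    ∏ j ∈ Finset.range (l * I + 1), (1 - xiSub l j) =
      EPart I (-t) * ∏ m ∈ Finset.Ico 1 l, EPart I (-s m) := by
  induction I with
  | zero => simp [EPart, xiSub]
  | succ I ih =>
    have h1 : l * (I + 1) + 1 = l * I + 1 + l := by ring
    rw [h1, Finset.prod_range_add, ih, prod_range_block hl (fun j => 1 - xiSub l j),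
      xiSub_mul_succ hl, EPart_succ, Finset.prod_congr rfl fun m _ => EPart_succ I (-s m),
      Finset.prod_mul_distrib, Finset.prod_congr rfl fun m hm =>
        show 1 - xiSub l (l * I + m) = 1 + -s m * Y I by
          rw [xiSub_mul_add hm, neg_mul, ← sub_eq_add_neg]]
    ring

theorem prod_one_sub_zetaSub (hl : 0 < l) (I : ℕ) :
    ∏ j ∈ Finset.range (l * I + 1), (1 - zetaSub l j) =
      (1 - r 0 * Y I) * (EPart I (-r 0) * ∏ m ∈ Finset.Ico 1 l, EPart I (-(r m * s m))) := by
  induction I with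
  | zero => simp [EPart, zetaSub]
  | succ I ih =>
    have h1 : l * (I + 1) + 1 = l * I + 1 + l := by ring
    rw [h1, Finset.prod_range_add, ih, prod_range_block hl (fun j => 1 - zetaSub l j),
      zetaSub_mul hl, EPart_succ, Finset.prod_congr rfl fun m _ => EPart_succ I (-(r m * s m)),
      Finset.prod_mul_distrib, Finset.prod_congr rfl fun m hm =>
        show 1 - zetaSub l (l * I + m) = 1 + -(r m * s m) * Y I by
          rw [zetaSub_mul_add hm, neg_mul, ← sub_eq_add_neg]]
    ring

/-- Only the letters divisible by `l` contribute to the quotient of the weights of the decreases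
and the increases. -/
theorem prod_quotient (hl : 0 < l) (I k : ℕ) (hk : k < l) :
    ∏ j ∈ Finset.range (l * I + 1 + k), ((1 - xiSub l j) * Ring.inverse (1 - etaSub l j)) =
      HPart (I + 1) 1 * EPart I (-t) := by
  have hone : ∀ J, ∀ m ∈ Finset.Ico 1 l,
      (1 - xiSub l (l * J + m)) * Ring.inverse (1 - etaSub l (l * J + m)) = 1 := fun J m hm => by
    rw [xiSub_mul_add hm, etaSub_mul_add hm, Ring.mul_inverse_cancel _ (isUnit_one_sub _ _)]
  have h0 : ∏ j ∈ Finset.range (l * I + 1),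
      ((1 - xiSub l j) * Ring.inverse (1 - etaSub l j)) = HPart (I + 1) 1 * EPart I (-t) := by
    clear hk k
    induction I with
    | zero => simp [EPart, HPart, xiSub, etaSub]
    | succ I ih =>
      have h1 : l * (I + 1) + 1 = l * I + 1 + l := by ring
      rw [h1, Finset.prod_range_add, ih,
        prod_range_block hl (fun j => (1 - xiSub l j) * Ring.inverse (1 - etaSub l j)),
        Finset.prod_eq_one (hone I), xiSub_mul_succ hl, etaSub_mul hl, EPart_succ,
        HPart_succ (I + 1), one_mul, neg_mul, ← sub_eq_add_neg, one_mul]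
      ring
  rw [Finset.prod_range_add, h0, Finset.prod_eq_one, mul_one]
  intro j hj
  rw [add_assoc, add_comm 1 j]
  exact hone I _ (by simp only [Finset.mem_range] at hj; simp; omega)

/-- The sum telescopes: its increment from `l I` to `l (I + 1)` is a multiple of the increment
of the quotient of the partial products of `H(Y)` and `H(tY)`. -/
theorem decreaseSum_sub (hl : 0 < l) (I : ℕ) :
    (1 - t) * decreaseSum (xiSub l) (etaSub l) (l * I + 1) =
      (1 + ∑ m ∈ Finset.Ico 1 l, s m) -
        (t + ∑ m ∈ Finset.Ico 1 l, s m) * (HPart I 1 * EPart I (-t)) := by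
  induction I with
  | zero => simp [EPart, HPart, decreaseSum, xiSub]
  | succ I ih =>
    have h1 : l * (I + 1) + 1 = l * I + 1 + l := by ring
    have h2 : ∑ k ∈ Finset.range l, xiSub l (l * I + 1 + k) *
        ∏ j ∈ Finset.range (l * I + 1 + k), ((1 - xiSub l j) * Ring.inverse (1 - etaSub l j)) =
        ((∑ m ∈ Finset.Ico 1 l, s m) + t) * Y I * (HPart (I + 1) 1 * EPart I (-t)) := by
      rw [Finset.sum_congr rfl fun k hk =>
        show _ = xiSub l (l * I + 1 + k) * (HPart (I + 1) 1 * EPart I (-t)) by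
          rw [prod_quotient hl I k (Finset.mem_range.mp hk)], ← Finset.sum_mul,
        sum_range_block hl (xiSub l), xiSub_mul_succ hl,
        Finset.sum_congr rfl fun m hm => xiSub_mul_add hm I, ← Finset.sum_mul]
      ring
    have h3 : decreaseSum (xiSub l) (etaSub l) (l * (I + 1) + 1) =
        decreaseSum (xiSub l) (etaSub l) (l * I + 1) -
          ((∑ m ∈ Finset.Ico 1 l, s m) + t) * Y I * (HPart (I + 1) 1 * EPart I (-t)) := by
      rw [decreaseSum, decreaseSum, h1, Finset.sum_range_add, h2]
      ring
    have h4 := Ring.inverse_mul_cancel _ (isUnit_one_sub 1 I)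
    rw [h3, mul_sub, ih, EPart_succ, HPart_succ]
    linear_combination ((t + ∑ m ∈ Finset.Ico 1 l, s m) * HPart I 1 * EPart I (-t)) * h4

/-- The generating function of the words over `{0, …, l I}`. -/
theorem wordSum_sub (hl : 0 < l) (I : ℕ) :
    wordSum (xiSub l) (etaSub l) (zetaSub l) (l * I + 1) 0 =
      numer l (HPart I) (EPart I) * Ring.inverse (denom l (HPart I)) *
        Ring.inverse (1 - r 0 * Y I) := by
  have h1 := wordSum_mul_decreaseSum (constantCoeff_xiSub (l := l))
    (constantCoeff_etaSub (l := l)) (constantCoeff_zetaSub (l := l)) (l * I + 1)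
  rw [prod_one_sub_xiSub hl, prod_one_sub_zetaSub hl] at h1
  have h2 := decreaseSum_sub hl I
  have hr := EPart_neg_mul_HPart I (r 0)
  have ht := EPart_neg_mul_HPart I t
  have hrs : (∏ m ∈ Finset.Ico 1 l, EPart I (-(r m * s m))) *
      ∏ m ∈ Finset.Ico 1 l, HPart I (r m * s m) = 1 := by
    rw [← Finset.prod_mul_distrib]
    exact Finset.prod_eq_one fun m _ => EPart_neg_mul_HPart I _
  have hd := Ring.mul_inverse_cancel _
    (isUnit_of_constantCoeff (constantCoeff_denom (l := l) (constantCoeff_HPart I)))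
  have hY := Ring.mul_inverse_cancel _ (isUnit_one_sub (r 0) I)
  have key : wordSum (xiSub l) (etaSub l) (zetaSub l) (l * I + 1) 0 * denom l (HPart I) *
      (1 - r 0 * Y I) = numer l (HPart I) (EPart I) := by
    rw [numer, denom, Finset.prod_mul_distrib]
    set W := wordSum (xiSub l) (etaSub l) (zetaSub l) (l * I + 1) 0
    set D := decreaseSum (xiSub l) (etaSub l) (l * I + 1)
    set S := ∑ m ∈ Finset.Ico 1 l, s m
    set P := ∏ m ∈ Finset.Ico 1 l, HPart I (r m * s m)
    set Q := ∏ m ∈ Finset.Ico 1 l, EPart I (-(r m * s m))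
    set E := ∏ m ∈ Finset.Ico 1 l, EPart I (-s m)
    have e1 : (1 + S) * HPart I t - (t + S) * HPart I 1 = (1 - t) * D * HPart I t := by
      linear_combination (-HPart I t) * h2 + (t + S) * HPart I 1 * ht
    have e2 : W * (1 - r 0 * Y I) * D = EPart I (-t) * E * HPart I (r 0) * P := by
      linear_combination (HPart I (r 0) * P) * h1 - W * (1 - r 0 * Y I) * D * hrs -
        W * (1 - r 0 * Y I) * D * Q * P * hr
    rw [e1]
    linear_combination ((1 - t) * HPart I t) * e2 + (1 - t) * E * HPart I (r 0) * P * ht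
  rw [← key]
  set W := wordSum (xiSub l) (etaSub l) (zetaSub l) (l * I + 1) 0
  linear_combination (-W) * hd - W * denom l (HPart I) * Ring.inverse (denom l (HPart I)) * hY

end Substitution

theorem tendsto_numer_mul_inverse_denom {l : ℕ} {HI EI : ℕ → A → A} {H E : A → A}
    (hH : ∀ a, Tendsto (fun I => HI I a) atTop (𝓝 (H a)))
    (hE : ∀ a, Tendsto (fun I => EI I a) atTop (𝓝 (E a)))
    (hI : ∀ I, IsUnit (denom l (HI I))) (h1 : IsUnit (denom l H)) :
    Tendsto (fun I => numer l (HI I) (EI I) * Ring.inverse (denom l (HI I))) atTop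
      (𝓝 (numer l H E * Ring.inverse (denom l H))) := by
  refine Tendsto.mul ?_ (tendsto_inverse ?_ hI h1)
  · exact ((hH _).mul_const _).mul (tendsto_finsetProd _ fun m _ => (hE _).mul (hH _))
  · exact ((hH _).const_mul _).sub ((hH _).const_mul _)

theorem tendsto_Y : Tendsto Y atTop (𝓝 0) := by
  have h1 := (MvPowerSeries.WithPiTopology.variables_tendsto_zero (σ := Var) (R := ℤ)).comp
    (Function.Injective.tendsto_cofinite (f := Var.Y) fun a b h => by cases h; rfl)
  rwa [Nat.cofinite_eq_atTop] at h1

theorem tendsto_of_subseq {u : ℕ → A} {a : A} {φ : ℕ → ℕ} (hφ : Tendsto φ atTop atTop)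
    (hu : Tendsto (fun N => u (N + 1) - u N) atTop (𝓝 0))
    (ha : Tendsto (fun I => u (φ I)) atTop (𝓝 a)) : Tendsto u atTop (𝓝 a) := by
  rw [tendsto_iff_eventually_coeff] at hu ha ⊢
  intro d
  obtain ⟨N₀, hN₀⟩ := eventually_atTop.mp (hu d)
  have hconst : ∀ N ≥ N₀, MvPowerSeries.coeff d (u N) = MvPowerSeries.coeff d (u N₀) := by
    intro N hN
    induction N, hN using Nat.le_induction with
    | base => rfl
    | succ N hN ih =>
      have h1 := hN₀ N hN
      rw [map_sub, map_zero, sub_eq_zero] at h1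
      rw [h1, ih]
  obtain ⟨I, hI1, hI2⟩ := ((ha d).and (hφ.eventually_ge_atTop N₀)).exists
  filter_upwards [eventually_ge_atTop N₀] with N hN
  rw [hconst N hN, ← hconst _ hI2, hI1]

theorem tendsto_wordSum {l : ℕ} (hl : 0 < l) :
    Tendsto (fun N => wordSum (xiSub l) (etaSub l) (zetaSub l) N 0) atTop
      (𝓝 (numer l HY EY * Ring.inverse (denom l HY))) := by
  have hdiv : Tendsto (fun N => N / l) atTop atTop := Nat.tendsto_div_const_atTop hl.ne'
  have hY := tendsto_Y.comp hdiv
  have hY' := tendsto_Y.comp ((tendsto_sub_atTop_nat 1).comp hdiv)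
  have hξ : Tendsto (xiSub l) atTop (𝓝 0) := by
    have h1 := (tendsto_mul_zero hY' fun j => if j = 0 then 0 else if j % l = 0 then t else 0).add
      (tendsto_mul_zero hY fun j => if j % l = 0 then 0 else s (j % l))
    rw [add_zero] at h1
    refine h1.congr fun j => ?_
    by_cases h0 : j = 0
    · simp [xiSub, h0]
    · by_cases h2 : j % l = 0 <;> simp [xiSub, h0, h2]
  have hζ : Tendsto (zetaSub l) atTop (𝓝 0) := by
    refine (tendsto_mul_zero hY fun j => if j % l = 0 then r 0 else r (j % l) * s (j % l)).congr
      fun j => ?_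
    by_cases h2 : j % l = 0 <;> simp [zetaSub, h2]
  have hsub : Tendsto (fun I => l * I + 1) atTop atTop :=
    tendsto_atTop_mono (fun I => (Nat.le_mul_of_pos_left I hl).trans (Nat.le_succ _)) tendsto_id
  refine tendsto_of_subseq hsub ?_ ?_
  · have h1 := ((tendsto_mul_zero hζ fun N =>
        wordSum (xiSub l) (etaSub l) (zetaSub l) (N + 1) 0).add (tendsto_mul_zero hξ fun N =>
        wordSum (xiSub l) (etaSub l) (zetaSub l) (N + 1) 0 * (1 - zetaSub l N) *
          wordSum (xiSub l) (etaSub l) (etaSub l) N 0)).sub (tendsto_mul_zero hξ fun N =>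
        wordSum (xiSub l) (etaSub l) (zetaSub l) N 0)
    rw [add_zero, sub_zero] at h1
    refine h1.congr fun N => ?_
    have h2 := wordSum_recursion (constantCoeff_xiSub (l := l)) (constantCoeff_etaSub (l := l))
      (constantCoeff_zetaSub (l := l)) N
    linear_combination -h2
  · have hr : Tendsto (fun I => Ring.inverse (1 - r 0 * Y I)) atTop (𝓝 1) := by
      have h1 : Tendsto (fun I => 1 - r 0 * Y I) atTop (𝓝 1) := by
        simpa using (tendsto_const_nhds (x := (1 : A))).sub (tendsto_Y.const_mul (r 0))
      simpa using tendsto_inverse h1 (isUnit_one_sub _) isUnit_one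
    have h1 := (tendsto_numer_mul_inverse_denom (l := l) tendsto_HPart tendsto_EPart
      (fun I => isUnit_of_constantCoeff (constantCoeff_denom (constantCoeff_HPart I)))
      (isUnit_of_constantCoeff (constantCoeff_denom constantCoeff_HY))).mul hr
    rw [mul_one] at h1
    exact h1.congr fun I => (wordSum_sub hl I).symm

/-! ### Compatible pairs of a colored permutation and an index sequence -/

section Compatible

variable {l n : ℕ}

theorem isExc_iff (π : ColPerm l n) (j : Fin n) :
    IsExc π j ↔ (π.2 j : ℕ) = 0 ∧ j < π.1 j := by
  unfold IsExc colKey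
  rw [Prod.Lex.toLex_lt_toLex]
  simp only [OrderDual.toDual_lt_toDual, OrderDual.toDual_inj, Nat.not_lt_zero, false_or]
  exact and_congr_left' eq_comm

open Classical in
/-- The class of the letter of `π` at `j` in the order of marked letters: `0` for an excedance,
and `l - c` for another letter of color `c`. -/
def zone (π : ColPerm l n) (j : Fin n) : ℕ := if IsExc π j then 0 else l - π.2 j

theorem markedLetter_lt_iff (π : ColPerm l n) (j j' : Fin n) :
    markedLetter π j < markedLetter π j' ↔
      zone π j < zone π j' ∨ (zone π j = zone π j' ∧ π.1 j < π.1 j') := by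
  have h1 := (π.2 j).2
  have h2 := (π.2 j').2
  unfold markedLetter zone colKey
  rw [Prod.Lex.toLex_lt_toLex, Prod.Lex.toLex_lt_toLex]
  simp only [OrderDual.toDual_lt_toDual, OrderDual.toDual_inj]
  by_cases e1 : IsExc π j <;> by_cases e2 : IsExc π j' <;> simp only [e1, e2, if_true, if_false]
  · have := (isExc_iff π j).mp e1
    have := (isExc_iff π j').mp e2
    simp only [lt_irrefl, false_or, true_and]; omega
  · simp only [zero_lt_one, true_or, true_iff]; omega
  · omega
  · simp only [lt_irrefl, false_or, true_and]; omega

/-- The position `j` comes before `j'` in the lexicographic order by decreasing index `i`,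
increasing class `ζ` and increasing value of `σ`. -/
def Precedes (σ : Equiv.Perm (Fin n)) (ζ : Fin n → ℕ) (i : Fin n → ℕ+) (j j' : Fin n) : Prop :=
  i j' < i j ∨ (i j = i j' ∧ (ζ j < ζ j' ∨ (ζ j = ζ j' ∧ σ j < σ j')))

section Precedes

variable {σ : Equiv.Perm (Fin n)} {ζ : Fin n → ℕ} {i : Fin n → ℕ+}

theorem Precedes.trans {j₁ j₂ j₃ : Fin n}
    (h1 : Precedes σ ζ i j₁ j₂) (h2 : Precedes σ ζ i j₂ j₃) : Precedes σ ζ i j₁ j₃ := by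
  unfold Precedes at *
  rcases h1 with h1 | ⟨h1, h1'⟩ <;> rcases h2 with h2 | ⟨h2, h2'⟩
  · exact Or.inl (h2.trans h1)
  · exact Or.inl (h2 ▸ h1)
  · exact Or.inl (h1 ▸ h2)
  · exact Or.inr ⟨h1.trans h2, by omega⟩

theorem antitone_of_precedes (h : ∀ j j', j < j' → Precedes σ ζ i j j') : Antitone i := by
  intro j j' hj
  rcases hj.eq_or_lt with rfl | hj
  · exact le_rfl
  · rcases h j j' hj with h1 | h1
    exacts [h1.le, h1.1.ge]

theorem zone_mono_of_precedes (h : ∀ j j', j < j' → Precedes σ ζ i j j') {j j' : Fin n}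
    (hj : j ≤ j') (hi : i j = i j') : ζ j ≤ ζ j' := by
  rcases hj.eq_or_lt with rfl | hj
  · exact le_rfl
  · rcases h j j' hj with h1 | ⟨-, h1⟩
    · exact absurd hi h1.ne'
    · omega

/-- Between two positions with the same index and the same class, `σ` increases by at least one
at each step. -/
theorem gap_of_precedes (h : ∀ j j', j < j' → Precedes σ ζ i j j') {j j' : Fin n}
    (hj : j ≤ j') (hi : i j = i j') (hz : ζ j = ζ j') : (σ j : ℕ) + (j' - j) ≤ σ j' := by
  obtain ⟨d, hd⟩ := Nat.exists_eq_add_of_le (Fin.le_def.mp hj)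
  induction d generalizing j' with
  | zero => obtain rfl : j' = j := Fin.ext (by omega)
            omega
  | succ d ih =>
    let k : Fin n := ⟨j + d, by omega⟩
    have hjk : j ≤ k := Fin.le_def.mpr (by simp [k])
    have hkj' : k < j' := Fin.lt_def.mpr (by simp [k]; omega)
    have h1 : i k = i j :=
      le_antisymm (antitone_of_precedes h hjk) (hi ▸ antitone_of_precedes h hkj'.le)
    have h2 := zone_mono_of_precedes h hkj'.le (h1.trans hi)
    have h3 := zone_mono_of_precedes h hjk h1.symm
    have h4 := ih hjk h1.symm (by omega) rfl
    have h5 : σ k < σ j' := by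
      rcases h k j' hkj' with hc | ⟨-, hc⟩
      · exact absurd (h1.trans hi) hc.ne'
      · omega
    have h6 := Fin.lt_def.mp h5
    simp only [k] at h4 h6 ⊢
    omega

end Precedes

/-- The index sequences that are summed over in `F n (DEX π)`, see `isCompatible_iff`: within a
block of equal indices the marked letters increase. -/
def IsCompatible (π : ColPerm l n) (i : Fin n → ℕ+) : Prop := ∀ j j', j < j' →
  Precedes π.1 (zone π) i j j'

theorem isCompatible_iff (π : ColPerm l n) (i : Fin n → ℕ+) :
    IsCompatible π i ↔
      Antitone i ∧ ∀ j j' : Fin n, (j' : ℕ) = j + 1 → j ∈ DEX π → i j' < i j := by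
  constructor
  · intro h
    refine ⟨antitone_of_precedes h, ?_⟩
    · rintro j j' hj ⟨j'', hj'', hlt⟩
      obtain rfl : j'' = j' := Fin.ext (by omega)
      rcases h j j'' (Fin.lt_def.mpr (by omega)) with h1 | ⟨-, h1⟩
      · exact h1
      · exact absurd ((markedLetter_lt_iff π _ _).mpr h1) (lt_asymm hlt)
  · rintro ⟨h1, h2⟩
    have hadj : ∀ j j' : Fin n, (j' : ℕ) = j + 1 → Precedes π.1 (zone π) i j j' := by
      intro j j' hj
      have hle : i j' ≤ i j := h1 (Fin.le_def.mpr (by omega))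
      rcases hle.lt_or_eq with hlt | heq
      · exact Or.inl hlt
      · refine Or.inr ⟨heq.symm, ?_⟩
        have hD : ¬ markedLetter π j' < markedLetter π j :=
          fun hD => heq.not_lt (h2 j j' hj ⟨j', hj, hD⟩)
        rw [markedLetter_lt_iff] at hD
        have hne : π.1 j ≠ π.1 j' := fun hc => by
          have := congrArg Fin.val (π.1.injective hc); omega
        have hne' : (π.1 j : ℕ) ≠ π.1 j' := fun hc => hne (Fin.ext hc)
        simp only [Fin.lt_def] at hD ⊢
        omega
    have hind : ∀ d : ℕ, ∀ j j' : Fin n, (j' : ℕ) = j + 1 + d → Precedes π.1 (zone π) i j j' := by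
      intro d
      induction d with
      | zero => exact hadj
      | succ d ih =>
        intro j j' hj
        exact (ih j ⟨j + 1 + d, by omega⟩ rfl).trans (hadj _ _ (by simp only; omega))
    exact fun j j' hj => hind (j' - (j + 1)) j j' (by have := Fin.lt_def.mp hj; omega)

end Compatible

/-! ### Insertion of a fixed point -/

section Insertion

variable {l n : ℕ}

/-- The permutation of `Fin (n + 1)` with the additional fixed point `p`. -/
def insPerm (p : Fin (n + 1)) (σ : Equiv.Perm (Fin n)) : Equiv.Perm (Fin (n + 1)) :=
  (finSuccEquiv' p).symm.permCongr (Equiv.optionCongr σ)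

theorem insPerm_self (p : Fin (n + 1)) (σ : Equiv.Perm (Fin n)) : insPerm p σ p = p := by
  simp [insPerm, Equiv.permCongr_apply]

theorem insPerm_succAbove (p : Fin (n + 1)) (σ : Equiv.Perm (Fin n)) (j : Fin n) :
    insPerm p σ (p.succAbove j) = p.succAbove (σ j) := by
  simp [insPerm, Equiv.permCongr_apply]

theorem exists_insPerm {p : Fin (n + 1)} {σ : Equiv.Perm (Fin (n + 1))} (hp : σ p = p) :
    ∃ σ', σ = insPerm p σ' := by
  refine ⟨Equiv.removeNone ((finSuccEquiv' p).permCongr σ), ?_⟩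
  have h : Equiv.optionCongr (Equiv.removeNone ((finSuccEquiv' p).permCongr σ)) =
      (finSuccEquiv' p).permCongr σ := by
    have h0 : ((finSuccEquiv' p).permCongr σ) none = none := by simp [Equiv.permCongr_apply, hp]
    rw [map_equiv_removeNone, h0, Equiv.swap_self]
    rfl
  rw [insPerm, h]
  ext j
  simp [Equiv.permCongr_apply]

/-- The colored permutation with the additional fixed point `p` of color `m`. -/
def insColPerm (p : Fin (n + 1)) (m : Fin l) (π : ColPerm l n) : ColPerm l (n + 1) :=
  (insPerm p π.1, p.insertNth (α := fun _ => Fin l) m π.2)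

variable (p : Fin (n + 1)) (m : Fin l) (π : ColPerm l n)

theorem isExc_insColPerm_succAbove (j : Fin n) :
    IsExc (insColPerm p m π) (p.succAbove j) ↔ IsExc π j := by
  rw [isExc_iff, isExc_iff]
  simp [insColPerm, insPerm_succAbove]

theorem not_isExc_of_fixed {π : ColPerm l n} {j : Fin n} (hj : π.1 j = j) : ¬ IsExc π j := by
  rw [isExc_iff, hj]; simp

theorem zone_of_fixed {π : ColPerm l n} {j : Fin n} (hj : π.1 j = j) : zone π j = l - π.2 j := by
  rw [zone, if_neg (not_isExc_of_fixed hj)]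

theorem zone_insColPerm_self : zone (insColPerm p m π) p = l - m := by
  rw [zone_of_fixed (insPerm_self p π.1)]; simp [insColPerm]

theorem zone_insColPerm_succAbove (j : Fin n) :
    zone (insColPerm p m π) (p.succAbove j) = zone π j := by
  classical
  unfold zone
  simp only [isExc_insColPerm_succAbove]
  simp [insColPerm]

/-- `j` has to stand before an inserted fixed point with color `m` and index `b`. Among the
letters of the same class and index these are the letters with `π j ≤ j`: the value of an inserted
fixed point is its position, and `π j - j` is weakly increasing there. -/
def IsBefore (π : ColPerm l n) (i : Fin n → ℕ+) (m : Fin l) (b : ℕ+) (j : Fin n) : Prop :=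
  b < i j ∨ (i j = b ∧ (zone π j < l - m ∨ (zone π j = l - m ∧ π.1 j ≤ j)))

theorem IsCompatible.isBefore_of_lt {π : ColPerm l n} {i : Fin n → ℕ+} (h : IsCompatible π i)
    {m : Fin l} {b : ℕ+} {j j' : Fin n} (hj : j < j') (hb : IsBefore π i m b j') :
    IsBefore π i m b j := by
  unfold IsBefore at *
  rcases h j j' hj with h1 | ⟨h1, h2⟩
  · left
    rcases hb with hb | ⟨hb, -⟩
    exacts [hb.trans h1, hb ▸ h1]
  · rw [h1]
    rcases hb with hb | ⟨hb, hb'⟩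
    · exact Or.inl hb
    · refine Or.inr ⟨hb, ?_⟩
      by_cases hz : zone π j = zone π j'
      · have := gap_of_precedes h hj.le h1 hz
        simp only [Fin.le_def, Fin.lt_def] at *
        omega
      · omega

open Classical in
/-- The position of an inserted fixed point with color `m` and index `b`; it comes behind all
present ones. -/
def insPos (π : ColPerm l n) (i : Fin n → ℕ+) (m : Fin l) (b : ℕ+) : Fin (n + 1) :=
  ⟨(Finset.univ.filter (IsBefore π i m b)).card,
    Nat.lt_succ_of_le ((Finset.card_le_univ _).trans (by simp))⟩

theorem IsCompatible.isBefore_iff {π : ColPerm l n} {i : Fin n → ℕ+} (h : IsCompatible π i)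
    {m : Fin l} {b : ℕ+} {j : Fin n} :
    IsBefore π i m b j ↔ (insPos π i m b).succAbove j < insPos π i m b := by
  classical
  have h1 := Fin.lt_card_filter_univ_iff_apply_of_imp (j := j) (IsBefore π i m b)
    fun j j' hj hb => by
      rcases hj.eq_or_lt with rfl | hj
      exacts [hb, h.isBefore_of_lt hj hb]
  rw [← h1, Fin.succAbove_lt_iff_castSucc_lt, Fin.lt_def, insPos, Fin.val_castSucc]

theorem IsCompatible.insert {π : ColPerm l n} {i : Fin n → ℕ+} (h : IsCompatible π i)
    (m : Fin l) (b : ℕ+) : IsCompatible (insColPerm (insPos π i m b) m π)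
      ((insPos π i m b).insertNth (α := fun _ => ℕ+) b i) := by
  have hb := fun j => h.isBefore_iff (m := m) (b := b) (j := j)
  set p := insPos π i m b
  intro ĵ ĵ' hj
  rcases Fin.eq_self_or_eq_succAbove p ĵ with rfl | ⟨j, rfl⟩ <;>
    rcases Fin.eq_self_or_eq_succAbove p ĵ' with h' | ⟨j', rfl⟩
  · exact absurd (h' ▸ hj) (lt_irrefl _)
  · have h1 : ¬ IsBefore π i m b j' := fun hc => lt_asymm hj ((hb j').mp hc)
    unfold Precedes
    rw [zone_insColPerm_succAbove, zone_insColPerm_self, Fin.insertNth_apply_same,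
      Fin.insertNth_apply_succAbove]
    simp only [insColPerm, insPerm_self, insPerm_succAbove]
    simp only [IsBefore, not_or, not_and, not_lt, not_le] at h1
    rcases h1.1.lt_or_eq with h2 | h2
    · exact Or.inl h2
    · refine Or.inr ⟨h2.symm, ?_⟩
      obtain ⟨h3, h4⟩ := h1.2 h2
      rcases h3.lt_or_eq with h3 | h3
      · exact Or.inl h3
      · refine Or.inr ⟨h3, ?_⟩
        have h5 := h4 h3.symm
        exact hj.trans (Fin.succAbove_lt_succAbove_iff.mpr h5)
  · subst h'
    have h1 : IsBefore π i m b j := (hb j).mpr hj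
    unfold Precedes
    rw [zone_insColPerm_succAbove, zone_insColPerm_self, Fin.insertNth_apply_same,
      Fin.insertNth_apply_succAbove]
    simp only [insColPerm, insPerm_self, insPerm_succAbove]
    rcases h1 with h1 | ⟨h1, h2⟩
    · exact Or.inl h1
    · refine Or.inr ⟨h1, ?_⟩
      rcases h2 with h2 | ⟨h2, h3⟩
      · exact Or.inl h2
      · exact Or.inr ⟨h2, lt_of_le_of_lt (Fin.succAbove_le_succAbove_iff.mpr h3) hj⟩
  · have := h j j' (by simpa using hj)
    unfold Precedes at this ⊢
    rw [zone_insColPerm_succAbove, zone_insColPerm_succAbove]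
    simpa [insColPerm, insPerm_succAbove] using this

/-- The position `p` is the last fixed point with color `m` and index `b`. -/
def IsLastFixed (π : ColPerm l n) (i : Fin n → ℕ+) (m : Fin l) (b : ℕ+) (p : Fin n) : Prop :=
  (π.1 p = p ∧ π.2 p = m ∧ i p = b) ∧ ∀ j, p < j → ¬ (π.1 j = j ∧ π.2 j = m ∧ i j = b)

theorem IsLastFixed.unique {π : ColPerm l n} {i : Fin n → ℕ+} {m : Fin l} {b : ℕ+}
    {p q : Fin n} (hp : IsLastFixed π i m b p) (hq : IsLastFixed π i m b q) : p = q := by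
  rcases lt_trichotomy p q with h | h | h
  · exact absurd hq.1 (hp.2 q h)
  · exact h
  · exact absurd hp.1 (hq.2 p h)

theorem exists_isLastFixed {π : ColPerm l n} {i : Fin n → ℕ+} {m : Fin l} {b : ℕ+}
    (h : ∃ p, π.1 p = p ∧ π.2 p = m ∧ i p = b) : ∃ p, IsLastFixed π i m b p := by
  classical
  obtain ⟨p, hp⟩ := h
  have hne : (Finset.univ.filter fun p => π.1 p = p ∧ π.2 p = m ∧ i p = b).Nonempty :=
    ⟨p, by simpa using hp⟩
  refine ⟨Finset.max' _ hne, by simpa using Finset.max'_mem _ hne, fun j hj hc => ?_⟩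
  exact absurd (Finset.le_max' _ j (by simpa using hc)) (not_le.mpr hj)

theorem IsCompatible.isLastFixed_insert {π : ColPerm l n} {i : Fin n → ℕ+}
    (h : IsCompatible π i) (m : Fin l) (b : ℕ+) :
    IsLastFixed (insColPerm (insPos π i m b) m π)
      ((insPos π i m b).insertNth (α := fun _ => ℕ+) b i) m b (insPos π i m b) := by
  have hb := fun j => h.isBefore_iff (m := m) (b := b) (j := j)
  set p := insPos π i m b
  refine ⟨⟨insPerm_self _ _, by simp [insColPerm], by simp⟩, fun ĵ hj => ?_⟩
  rcases Fin.eq_self_or_eq_succAbove p ĵ with rfl | ⟨j, rfl⟩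
  · exact absurd hj (lt_irrefl _)
  · rintro ⟨h1, h2, h3⟩
    simp only [insColPerm, insPerm_succAbove, Fin.succAbove_right_inj,
      Fin.insertNth_apply_succAbove] at h1 h2 h3
    exact lt_asymm hj ((hb j).mp (Or.inr ⟨h3, Or.inr ⟨by rw [zone_of_fixed h1, h2], h1.le⟩⟩))

theorem IsCompatible.of_insert {p : Fin (n + 1)} {m : Fin l} {b : ℕ+} {π : ColPerm l n}
    {i : Fin n → ℕ+}
    (h : IsCompatible (insColPerm p m π) (p.insertNth (α := fun _ => ℕ+) b i)) :
    IsCompatible π i := by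
  intro j j' hj
  have := h (p.succAbove j) (p.succAbove j') (by simpa using hj)
  unfold Precedes at this ⊢
  rw [zone_insColPerm_succAbove, zone_insColPerm_succAbove] at this
  simpa [insColPerm, insPerm_succAbove] using this

/-- If the deleted fixed point was the last one of its kind, it is inserted again at the same
position. -/
theorem insPos_eq {p : Fin (n + 1)} {m : Fin l} {b : ℕ+} {π : ColPerm l n} {i : Fin n → ℕ+}
    (h : IsCompatible (insColPerm p m π) (p.insertNth (α := fun _ => ℕ+) b i))
    (hp : IsLastFixed (insColPerm p m π) (p.insertNth (α := fun _ => ℕ+) b i) m b p) :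
    insPos π i m b = p := by
  classical
  have key : ∀ j, IsBefore π i m b j ↔ p.succAbove j < p := by
    intro j
    rcases lt_or_gt_of_ne (Fin.succAbove_ne p j) with hj | hj
    · refine iff_of_true ?_ hj
      have h1 := h _ _ hj
      unfold Precedes at h1
      rw [zone_insColPerm_succAbove, zone_insColPerm_self, Fin.insertNth_apply_same,
        Fin.insertNth_apply_succAbove] at h1
      rcases h1 with h1 | ⟨h1, h2 | ⟨h2, h3⟩⟩
      · exact Or.inl h1
      · exact Or.inr ⟨h1, Or.inl h2⟩
      · refine Or.inr ⟨h1, Or.inr ⟨h2, ?_⟩⟩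
        have h4 := gap_of_precedes h hj.le (by simpa using h1)
          (by rw [zone_insColPerm_succAbove, zone_insColPerm_self, h2])
        simp only [insColPerm, insPerm_self, insPerm_succAbove] at h4
        rw [← Fin.succAbove_le_succAbove_iff (p := p), Fin.le_def]
        have := Fin.lt_def.mp hj
        omega
    · refine iff_of_false (fun hB => ?_) (lt_asymm hj)
      have h1 := h _ _ hj
      unfold Precedes at h1
      rw [zone_insColPerm_succAbove, zone_insColPerm_self, Fin.insertNth_apply_same,
        Fin.insertNth_apply_succAbove] at h1
      rcases hB with hB | ⟨hB, hB'⟩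
      · rcases h1 with h1 | ⟨h1, -⟩
        · exact lt_asymm h1 hB
        · exact hB.ne h1
      · rcases h1 with h1 | ⟨-, h1⟩
        · exact h1.ne hB
        · have hz : l - (m : ℕ) = zone π j := by omega
          have h4 := gap_of_precedes h hj.le (by simpa using hB.symm)
            (by rw [zone_insColPerm_succAbove, zone_insColPerm_self, hz])
          have h5 : π.1 j ≤ j := by
            rcases hB' with hB' | hB'
            · omega
            · exact hB'.2
          simp only [insColPerm, insPerm_self, insPerm_succAbove] at h4
          have h6 := Fin.le_def.mp (Fin.succAbove_le_succAbove_iff (p := p).mpr h5)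
          have h7 : π.1 j = j := by
            apply Fin.succAbove_right_injective (p := p)
            apply Fin.ext
            have := Fin.lt_def.mp hj
            omega
          refine hp.2 _ hj ⟨?_, ?_, ?_⟩
          · simp [insColPerm, insPerm_succAbove, h7]
          · have h8 := zone_of_fixed h7
            have h9 := (π.2 j).2
            have h10 := m.2
            simp only [insColPerm, Fin.insertNth_apply_succAbove]
            apply Fin.ext
            omega
          · simpa using hB
  apply Fin.ext
  have key' : ∀ j, IsBefore π i m b j ↔ (j : ℕ) < p := fun j => by
    rw [key, Fin.succAbove_lt_iff_castSucc_lt, Fin.lt_def, Fin.val_castSucc]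
  simp only [insPos, key']
  rw [Fin.card_filter_val_lt, min_eq_right (Nat.lt_succ_iff.mp p.2)]

end Insertion

/-! ### Generating functions of compatible pairs -/

section Generating

/-- The compatible pairs of a colored permutation and an index sequence. -/
abbrev CompatiblePair (l : ℕ) : Type :=
  Σ n : ℕ, {p : ColPerm l n × (Fin n → ℕ+) // IsCompatible p.1 p.2}

variable {l n : ℕ}

open Classical in
/-- The weight of the letter at `j`: `ρ` at a fixed point (which may depend on the color and the
index), `τ` at an excedance, and `ν` (which may depend on the color) at the other positions. -/
def letterWeight (ρ : Fin l → ℕ+ → A) (τ : A) (ν : Fin l → A) (π : ColPerm l n)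
    (i : Fin n → ℕ+) (j : Fin n) : A :=
  if π.1 j = j then ρ (π.2 j) (i j) else if IsExc π j then τ else ν (π.2 j)

/-- The weight of a compatible pair. -/
def pairWeight (ρ : Fin l → ℕ+ → A) (τ : A) (ν : Fin l → A) (v : CompatiblePair l) : A :=
  ∏ j, (letterWeight ρ τ ν v.2.1.1 v.2.1.2 j * (x (v.2.1.2 j) * z))

/-- The generating function of the compatible pairs. -/
def pairSum (ρ : Fin l → ℕ+ → A) (τ : A) (ν : Fin l → A) : A :=
  ∑' v : CompatiblePair l, pairWeight ρ τ ν v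

theorem coeff_eq_zero_of_X_pow_dvd {v : Var} {k : ℕ} {f : A} {d : Var →₀ ℕ}
    (h : MvPowerSeries.X v ^ k ∣ f) (hd : d v < k) : MvPowerSeries.coeff d f = 0 :=
  MvPowerSeries.X_pow_dvd_iff.mp h d hd

theorem coeff_pairWeight_ne_zero {ρ : Fin l → ℕ+ → A} {τ : A} {ν : Fin l → A}
    {v : CompatiblePair l} {d : Var →₀ ℕ}
    (h : MvPowerSeries.coeff d (pairWeight ρ τ ν v) ≠ 0) :
    v.1 ≤ d Var.z ∧ ∀ j, d (Var.x (v.2.1.2 j)) ≠ 0 := by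
  constructor
  · by_contra hc
    refine h (coeff_eq_zero_of_X_pow_dvd (v := Var.z) (k := v.1) ?_ (not_le.mp hc))
    rw [pairWeight, Finset.prod_mul_distrib, Finset.prod_mul_distrib, Finset.prod_const]
    simp only [Finset.card_univ, Fintype.card_fin]
    exact ((dvd_refl _).mul_left _).mul_left _
  · intro j hc
    refine h (coeff_eq_zero_of_X_pow_dvd (v := Var.x (v.2.1.2 j)) (k := 1) ?_ (by omega))
    rw [pow_one]
    exact (((dvd_refl _).mul_right _).mul_left _).trans
      (Finset.dvd_prod_of_mem (fun j => letterWeight ρ τ ν v.2.1.1 v.2.1.2 j *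
        (x (v.2.1.2 j) * z)) (Finset.mem_univ j))

theorem finite_pairs (d : Var →₀ ℕ) :
    {v : CompatiblePair l | v.1 ≤ d Var.z ∧ ∀ j, d (Var.x (v.2.1.2 j)) ≠ 0}.Finite := by
  have hinj : Function.Injective Var.x := fun a b hab => by cases hab; rfl
  have hx : {b : ℕ+ | d (Var.x b) ≠ 0}.Finite := by
    refine (d.support.finite_toSet.preimage hinj.injOn).subset fun b hb => ?_
    simpa using hb
  have h1 : (⋃ n ∈ Set.Iic (d Var.z), Sigma.mk (β := fun n =>
      {p : ColPerm l n × (Fin n → ℕ+) // IsCompatible p.1 p.2}) n ''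
        {p | ∀ j, d (Var.x (p.1.2 j)) ≠ 0}).Finite := by
    refine (Set.finite_Iic _).biUnion fun n _ => Set.Finite.image _ ?_
    have h2 : {p : ColPerm l n × (Fin n → ℕ+) | ∀ j, d (Var.x (p.2 j)) ≠ 0}.Finite := by
      refine ((Set.finite_univ (α := ColPerm l n)).prod
        (Set.Finite.pi' fun _ : Fin n => hx)).subset fun p hp => ⟨Set.mem_univ _, hp⟩
    exact h2.preimage Subtype.val_injective.injOn
  refine h1.subset fun v hv => ?_
  simp only [Set.mem_iUnion]
  exact ⟨v.1, hv.1, v.2, hv.2, rfl⟩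

theorem summable_pairWeight (ρ : Fin l → ℕ+ → A) (τ : A) (ν : Fin l → A) :
    Summable (pairWeight ρ τ ν) :=
  summable_of_finite_coeff fun d => (finite_pairs d).subset fun _ hv => coeff_pairWeight_ne_zero hv

/-- Insertion of a fixed point with color `m` and index `b` into a compatible pair. -/
def insPair (m : Fin l) (b : ℕ+) (v : CompatiblePair l) : CompatiblePair l :=
  ⟨v.1 + 1, ⟨(insColPerm (insPos v.2.1.1 v.2.1.2 m b) m v.2.1.1,
    (insPos v.2.1.1 v.2.1.2 m b).insertNth (α := fun _ => ℕ+) b v.2.1.2), v.2.2.insert m b⟩⟩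

theorem insPerm_injective (p : Fin (n + 1)) : Function.Injective (insPerm p) := by
  intro σ σ' hσ
  ext j
  have := congrArg (fun σ => σ (p.succAbove j)) hσ
  simp only [insPerm_succAbove, Fin.succAbove_right_inj] at this
  rw [this]

theorem insertNth_injective {α : Type*} (p : Fin (n + 1)) (b : α) :
    Function.Injective fun f : Fin n → α => p.insertNth (α := fun _ => α) b f := by
  intro f f' hf
  funext j
  have := congrFun hf (p.succAbove j)
  simpa using this

theorem insPair_injective (m : Fin l) (b : ℕ+) : Function.Injective (insPair (l := l) m b) := by
  rintro ⟨n, ⟨⟨π, i⟩, h⟩⟩ ⟨n', ⟨⟨π', i'⟩, h'⟩⟩ heq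
  obtain rfl : n = n' := Nat.succ_injective (congrArg Sigma.fst heq)
  simp only [insPair, Sigma.mk.injEq, heq_eq_eq, true_and, Subtype.mk.injEq, Prod.mk.injEq] at heq
  have h1 := h.isLastFixed_insert m b
  simp only at h1
  rw [heq.1, heq.2] at h1
  have hp := h1.unique (h'.isLastFixed_insert m b)
  obtain ⟨e1, e2⟩ := heq
  rw [hp] at e1 e2
  obtain ⟨e3, e4⟩ := Prod.mk.inj e1
  have e5 := insPerm_injective _ e3
  have e6 := insertNth_injective _ _ e4
  have e7 := insertNth_injective _ _ e2
  obtain ⟨σ, ε⟩ := π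
  obtain ⟨σ', ε'⟩ := π'
  simp only at e5 e6
  subst e5 e6 e7
  rfl

theorem mem_range_insPair {m : Fin l} {b : ℕ+} {v : CompatiblePair l} {j : Fin v.1}
    (hj : v.2.1.1.1 j = j ∧ v.2.1.1.2 j = m ∧ v.2.1.2 j = b) : v ∈ Set.range (insPair m b) := by
  obtain ⟨n, ⟨⟨⟨σ, ε⟩, i⟩, h⟩⟩ := v
  cases n with
  | zero => exact j.elim0
  | succ n =>
    obtain ⟨p, hp⟩ : ∃ p : Fin (n + 1), IsLastFixed (σ, ε) i m b p := exists_isLastFixed ⟨j, hj⟩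
    clear hj j
    obtain ⟨σ', rfl⟩ := exists_insPerm hp.1.1
    obtain ⟨c, ε', rfl⟩ : ∃ c ε', ε = p.insertNth (α := fun _ => Fin l) c ε' :=
      ⟨ε p, p.removeNth ε, (Fin.insertNth_self_removeNth p ε).symm⟩
    obtain ⟨b', i', rfl⟩ : ∃ b' i', i = p.insertNth (α := fun _ => ℕ+) b' i' :=
      ⟨i p, p.removeNth i, (Fin.insertNth_self_removeNth p i).symm⟩
    have hcb : c = m ∧ b' = b := by simpa using hp.1.2
    obtain ⟨rfl, rfl⟩ := hcb
    have hpos := insPos_eq (π := (σ', ε')) h hp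
    refine ⟨⟨n, ⟨⟨(σ', ε'), i'⟩, IsCompatible.of_insert (p := p) (m := c) (b := b') h⟩⟩, ?_⟩
    simp only [insPair]
    congr 2
    simp only [hpos, insColPerm]

theorem pairWeight_insPair (ρ : Fin l → ℕ+ → A) (τ : A) (ν : Fin l → A) (m : Fin l) (b : ℕ+)
    (v : CompatiblePair l) :
    pairWeight ρ τ ν (insPair m b v) = ρ m b * (x b * z) * pairWeight ρ τ ν v := by
  obtain ⟨n, ⟨⟨π, i⟩, h⟩⟩ := v
  classical
  refine (Fin.prod_univ_succAbove _ (insPos π i m b)).trans ?_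
  simp only [insPair]
  refine congrArg₂ (· * ·) ?_ ?_
  · rw [letterWeight, if_pos (by exact insPerm_self _ _)]
    simp [insColPerm]
  · refine Finset.prod_congr rfl fun j _ => ?_
    rw [Fin.insertNth_apply_succAbove]
    congr 1
    simp only [letterWeight, isExc_insColPerm_succAbove]
    simp only [insColPerm, insPerm_succAbove, Fin.succAbove_right_inj,
      Fin.insertNth_apply_succAbove]

/-- Deleting a fixed point with color `m` and index `b` gives the factor `1 - ρ m b x_b z`. -/
theorem one_sub_mul_pairSum (ρ : Fin l → ℕ+ → A) (τ : A) (ν : Fin l → A) (m : Fin l) (b : ℕ+) :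
    (1 - ρ m b * (x b * z)) * pairSum ρ τ ν =
      pairSum (Function.update ρ m (Function.update (ρ m) b 0)) τ ν := by
  classical
  set ρ' := Function.update ρ m (Function.update (ρ m) b 0) with hρ'
  have h1 : pairSum ρ τ ν - pairSum ρ' τ ν = ρ m b * (x b * z) * pairSum ρ τ ν := by
    have s1 := summable_pairWeight ρ τ ν
    have s2 := summable_pairWeight ρ' τ ν
    have hρm : ρ' m b = 0 := by simp [hρ']
    rw [pairSum, pairSum, ← s1.tsum_sub s2, ← s1.tsum_mul_left,
      ← (insPair_injective m b).tsum_eq]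
    · refine tsum_congr fun v => ?_
      rw [pairWeight_insPair, pairWeight_insPair, hρm]
      ring
    · intro v hv
      by_contra hc
      refine hv ?_
      simp only [sub_eq_zero]
      refine Finset.prod_congr rfl fun j _ => ?_
      congr 1
      unfold letterWeight
      split_ifs with hj
      · by_cases hm : v.2.1.1.2 j = m
        · have hb : v.2.1.2 j ≠ b := fun hb => hc (mem_range_insPair ⟨hj, hm, hb⟩)
          rw [hρ', hm, Function.update_self, Function.update_of_ne hb]
        · rw [hρ', Function.update_of_ne hm]
      · rfl
      · rfl
  linear_combination h1

end Generating

/-! ### The generating functions of the elementary and complete homogeneous functions -/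

theorem tendsto_finsetProd_of_hasProd {ι : Type*} {f : ι → A} {a : A} (h : HasProd f a) :
    Tendsto (fun s : Finset ι => ∏ b ∈ s, f b) atTop (𝓝 a) := by
  simpa [HasProd] using h

theorem hasSum_of_forall_eq {ι : Type*} {f g : ι → A} {a : A} (hf : HasSum f a)
    (hfg : ∀ i, f i = g i) : HasSum g a := by
  rwa [← funext hfg]

theorem antitone_and_strict_iff {n : ℕ} (i : Fin n → ℕ+) :
    (Antitone i ∧ ∀ j j' : Fin n, (j' : ℕ) = j + 1 → j ∈ (Set.univ : Set (Fin n)) → i j' < i j) ↔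
      StrictAnti i := by
  constructor
  · rintro ⟨-, h⟩
    cases n with
    | zero => exact fun j => j.elim0
    | succ n => exact Fin.strictAnti_iff_succ_lt.mpr fun j => h j.castSucc j.succ (by simp) trivial
  · exact fun h => ⟨h.antitone, fun j j' hj _ => h (Fin.lt_def.mpr (by omega))⟩

/-- The sequences summed over in `e n` are the decreasing enumerations of the sets with `n`
elements. -/
theorem hasProd_Ez (a : A) : HasProd (fun b : ℕ+ => 1 + a * (x b * z)) (Ez a) := by
  classical
  apply hasProd_one_add_of_hasSum_prod
  let κ : Type := Σ n : ℕ, {i : Fin n → ℕ+ // Antitone i ∧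
    ∀ j j' : Fin n, (j' : ℕ) = j + 1 → j ∈ (Set.univ : Set (Fin n)) → i j' < i j}
  let g : κ → Finset ℕ+ := fun v => Finset.univ.image v.2.1
  have hanti : ∀ v : κ, StrictAnti v.2.1 := fun v => (antitone_and_strict_iff _).mp v.2.2
  have hcard : ∀ v : κ, (g v).card = v.1 := fun v => by
    rw [Finset.card_image_of_injective _ (hanti v).injective, Finset.card_univ, Fintype.card_fin]
  have hg : Function.Injective g := by
    intro v v' hv
    obtain ⟨n, i, hi⟩ := v
    obtain ⟨n', i', hi'⟩ := v'
    obtain rfl : n = n' := by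
      have h1 := hcard ⟨n, i, hi⟩
      rw [hv, hcard] at h1
      exact h1.symm
    have h1 : StrictMono (OrderDual.toDual ∘ i) := (antitone_and_strict_iff _).mp hi
    have h2 : StrictMono (OrderDual.toDual ∘ i') := (antitone_and_strict_iff _).mp hi'
    have h3 : Set.range i = Set.range i' := by
      have := congrArg (fun s : Finset ℕ+ => (s : Set ℕ+)) hv
      simpa [g] using this
    have h4 : OrderDual.toDual ∘ i = OrderDual.toDual ∘ i' := by
      rw [← StrictMono.range_inj h1 h2, Set.range_comp, Set.range_comp, h3]
    have h5 : i = i' := h4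
    subst h5
    rfl
  have hsurj : Function.Surjective g := by
    intro S
    refine ⟨⟨S.card, S.orderEmbOfFin rfl ∘ Fin.rev, (antitone_and_strict_iff _).mpr
      ((S.orderEmbOfFin rfl).strictMono.comp_strictAnti Fin.rev_strictAnti)⟩, ?_⟩
    simp only [g]
    rw [← Finset.coe_inj, Finset.coe_image, Finset.coe_univ, Set.image_univ,
      Fin.rev_surjective.range_comp, Finset.range_orderEmbOfFin]
  rw [← (Equiv.ofBijective g ⟨hg, hsurj⟩).hasSum_iff]
  have hval : ∀ v : κ, ∏ b ∈ g v, a * (x b * z) = (∏ j, x (v.2.1 j)) * (a * z) ^ v.1 := by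
    intro v
    rw [Finset.prod_image fun j _ j' _ h => (hanti v).injective h]
    calc _ = ∏ j, (x (v.2.1 j) * (a * z)) := Finset.prod_congr rfl fun j _ => by ring
      _ = _ := by rw [Finset.prod_mul_distrib, Finset.prod_const, Finset.card_univ,
                    Fintype.card_fin]
  have hsum : Summable fun v : κ => ∏ b ∈ g v, a * (x b * z) := by
    have h1 : Summable fun S : Finset ℕ+ => ∏ b ∈ S, a * (x b * z) := by
      apply summable_of_finite_coeff
      intro d
      have hinj : Function.Injective Var.x := fun a b hab => by cases hab; rfl
      refine ((d.support.preimage Var.x hinj.injOn).powerset.finite_toSet).subset fun S hS => ?_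
      simp only [Finset.coe_powerset, Set.mem_preimage, Set.mem_powerset_iff]
      intro b hb
      by_contra hc
      refine hS (coeff_eq_zero_of_X_pow_dvd (v := Var.x b) (k := 1) ?_ ?_)
      · rw [pow_one]
        exact ((dvd_mul_right _ _).mul_left _).trans
          (Finset.dvd_prod_of_mem (fun b => a * (x b * z)) hb)
      · simpa using hc
    exact h1.comp_injective hg
  have hfiber : ∀ n, HasSum (fun i : {i : Fin n → ℕ+ // Antitone i ∧
      ∀ j j' : Fin n, (j' : ℕ) = j + 1 → j ∈ (Set.univ : Set (Fin n)) → i j' < i j} =>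
        ∏ b ∈ g ⟨n, i⟩, a * (x b * z)) (e n * (a * z) ^ n) := by
    intro n
    have := (summable_F n fun i => Antitone i ∧
      ∀ j j' : Fin n, (j' : ℕ) = j + 1 → j ∈ (Set.univ : Set (Fin n)) → i j' < i j).hasSum.mul_right
        ((a * z) ^ n)
    refine hasSum_of_forall_eq this fun i => ?_
    rw [hval]
  have h2 := hsum.hasSum.sigma hfiber
  have h3 : Ez a = ∑' v : κ, ∏ b ∈ g v, a * (x b * z) := h2.tsum_eq
  rw [h3]
  exact hsum.hasSum

theorem constantCoeff_Ez (a : A) : MvPowerSeries.constantCoeff (Ez a) = 1 :=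
  constantCoeff_hasProd (hasProd_Ez a) fun b => by simp

section Elimination

variable {l : ℕ}

theorem coeff_pairSum_congr {ρ ρ' : Fin l → ℕ+ → A} (τ : A) (ν : Fin l → A) {d : Var →₀ ℕ}
    (h : ∀ m b, d (Var.x b) ≠ 0 → ρ m b = ρ' m b) :
    MvPowerSeries.coeff d (pairSum ρ τ ν) = MvPowerSeries.coeff d (pairSum ρ' τ ν) := by
  rw [pairSum, pairSum, coeff_tsum (summable_pairWeight ρ τ ν),
    coeff_tsum (summable_pairWeight ρ' τ ν)]
  refine tsum_congr fun v => ?_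
  by_cases hv : ∀ j, d (Var.x (v.2.1.2 j)) ≠ 0
  · congr 1
    refine Finset.prod_congr rfl fun j _ => ?_
    rw [letterWeight, letterWeight, h _ _ (hv j)]
  · have hzero : ∀ ρ : Fin l → ℕ+ → A, MvPowerSeries.coeff d (pairWeight ρ τ ν v) = 0 :=
      fun ρ => by_contra fun hc => hv (coeff_pairWeight_ne_zero hc).2
    rw [hzero, hzero]

open Classical in
theorem prod_one_sub_mul_pairSum (ρ : Fin l → ℕ+ → A) (τ : A) (ν : Fin l → A) (m : Fin l)
    (S : Finset ℕ+) :
    (∏ b ∈ S, (1 - ρ m b * (x b * z))) * pairSum ρ τ ν =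
      pairSum (Function.update ρ m fun b => if b ∈ S then 0 else ρ m b) τ ν := by
  induction S using Finset.induction_on with
  | empty => simp
  | insert b S hb ih =>
    have h1 := one_sub_mul_pairSum (Function.update ρ m fun b => if b ∈ S then 0 else ρ m b) τ ν m b
    rw [Finset.prod_insert hb, mul_assoc, ih]
    simp only [Function.update_self, hb, if_false, Function.update_idem] at h1
    rw [h1]
    congr 2
    funext b'
    by_cases hb' : b' = b
    · subst hb'; simp
    · simp [hb']

/-- All fixed points of color `m` are deleted. -/
theorem Ez_mul_pairSum (ρ : Fin l → ℕ+ → A) (τ : A) (ν : Fin l → A) (m : Fin l) {a : A}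
    (ha : ∀ b, ρ m b = a) :
    Ez (-a) * pairSum ρ τ ν = pairSum (Function.update ρ m 0) τ ν := by
  classical
  have h1 : Tendsto (fun S : Finset ℕ+ => (∏ b ∈ S, (1 - ρ m b * (x b * z))) * pairSum ρ τ ν)
      atTop (𝓝 (Ez (-a) * pairSum ρ τ ν)) := by
    refine Tendsto.mul_const _ ((tendsto_finsetProd_of_hasProd (hasProd_Ez (-a))).congr fun S => ?_)
    exact Finset.prod_congr rfl fun b _ => by rw [ha]; ring
  refine tendsto_nhds_unique h1 ?_
  rw [tendsto_iff_eventually_coeff]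
  intro d
  have hinj : Function.Injective Var.x := fun a b hab => by cases hab; rfl
  filter_upwards [eventually_ge_atTop (d.support.preimage Var.x hinj.injOn)] with S hS
  rw [prod_one_sub_mul_pairSum]
  refine coeff_pairSum_congr τ ν fun m' b hb => ?_
  have hbS : b ∈ S := hS (by simpa using hb)
  by_cases hm : m' = m
  · subst hm; simp [hbS]
  · simp [hm]

/-- The generating function of the pairs factors into the contribution of the fixed points and
that of the pairs without fixed points. -/
theorem prod_Ez_mul_pairSum (c : Fin l → A) (τ : A) (ν : Fin l → A) :
    (∏ m, Ez (-c m)) * pairSum (fun m _ => c m) τ ν = pairSum 0 τ ν := by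
  classical
  have key : ∀ S : Finset (Fin l), (∏ m ∈ S, Ez (-c m)) * pairSum (fun m _ => c m) τ ν =
      pairSum (fun m _ => if m ∈ S then 0 else c m) τ ν := by
    intro S
    induction S using Finset.induction_on with
    | empty => simp
    | insert m S hm ih =>
      rw [Finset.prod_insert hm, mul_assoc, ih,
        Ez_mul_pairSum _ τ ν m (a := c m) (fun b => by simp [hm])]
      congr 1
      funext m' b
      by_cases hm' : m' = m
      · subst hm'; simp
      · simp [hm']
  rw [key]
  congr 1
  funext m b
  simp

/-- The weight of a colored permutation if the weights of the fixed points do not depend on the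
indices. -/
def permWeight {n : ℕ} (c : Fin l → A) (τ : A) (ν : Fin l → A) (π : ColPerm l n) : A :=
  ∏ j, letterWeight (fun m _ => c m) τ ν π (fun _ => 1) j

/-- Expanding `F n (DEX π)` gives the pairs that contain `π`. -/
theorem hasSum_permWeight (c : Fin l → A) (τ : A) (ν : Fin l → A) :
    HasSum (fun y : Σ n : ℕ, ColPerm l n =>
      F y.1 (DEX y.2) * permWeight c τ ν y.2 * z ^ y.1) (pairSum (fun m _ => c m) τ ν) := by
  let e₀ : (Σ y : Σ n : ℕ, ColPerm l n, {i : Fin y.1 → ℕ+ // Antitone i ∧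
      ∀ j j' : Fin y.1, (j' : ℕ) = j + 1 → j ∈ DEX y.2 → i j' < i j}) ≃ CompatiblePair l :=
    { toFun := fun v => ⟨v.1.1, ⟨(v.1.2, v.2.1), (isCompatible_iff _ _).mpr v.2.2⟩⟩
      invFun := fun v => ⟨⟨v.1, v.2.1.1⟩, ⟨v.2.1.2, (isCompatible_iff _ _).mp v.2.2⟩⟩
      left_inv := fun v => rfl
      right_inv := fun v => rfl }
  have h1 := (e₀.hasSum_iff (f := pairWeight (fun m _ => c m) τ ν)).mpr
    (summable_pairWeight _ _ _).hasSum
  refine h1.sigma fun y => ?_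
  have h2 := ((summable_F y.1 fun i => Antitone i ∧
      ∀ j j' : Fin y.1, (j' : ℕ) = j + 1 → j ∈ DEX y.2 → i j' < i j).hasSum.mul_right
        (permWeight c τ ν y.2)).mul_right (z ^ y.1)
  refine hasSum_of_forall_eq h2 fun i => ?_
  change (∏ j, x (i.1 j)) * (∏ j, letterWeight (fun m _ => c m) τ ν y.2 (fun _ => 1) j) *
    z ^ y.1 = ∏ j : Fin y.1, (letterWeight (fun m _ => c m) τ ν y.2 (fun _ => 1) j *
      (x (i.1 j) * z))
  rw [Finset.prod_mul_distrib, Finset.prod_mul_distrib, Finset.prod_const, Finset.card_univ,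
    Fintype.card_fin]
  ring

theorem pairSum_zero (l : ℕ) : pairSum (l := l) 0 0 0 = 1 := by
  let v₀ : CompatiblePair l := ⟨0, ⟨((1, Fin.elim0), Fin.elim0), fun j => j.elim0⟩⟩
  rw [pairSum, tsum_eq_single v₀]
  · exact Finset.prod_of_isEmpty _
  · rintro ⟨n, ⟨⟨⟨σ, ε⟩, i⟩, h⟩⟩ hv
    cases n with
    | zero =>
      refine absurd ?_ hv
      obtain rfl : σ = 1 := Subsingleton.elim _ _
      obtain rfl : ε = Fin.elim0 := Subsingleton.elim _ _
      obtain rfl : i = Fin.elim0 := Subsingleton.elim _ _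
      rfl
    | succ n =>
      refine Finset.prod_eq_zero (Finset.mem_univ 0) ?_
      unfold letterWeight
      simp

/-- The antitone sequences are the sequences that are compatible with the identity. -/
theorem Hz_eq_pairSum (a : A) : Hz a = pairSum (l := 1) (fun _ _ => a) 0 0 := by
  have h1 := hasSum_permWeight (l := 1) (fun _ => a) 0 0
  let g : ℕ → Σ n : ℕ, ColPerm 1 n := fun n => ⟨n, (1, fun _ => 0)⟩
  have hg : Function.Injective g := fun n n' hn => congrArg Sigma.fst hn
  rw [← hg.hasSum_iff] at h1
  · refine Eq.trans ?_ h1.tsum_eq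
    refine tsum_congr fun n => ?_
    have hD : DEX (l := 1) ((1, fun _ => 0) : ColPerm 1 n) = ∅ := by
      refine Set.eq_empty_iff_forall_notMem.mpr ?_
      rintro j ⟨j', hj, hlt⟩
      rw [markedLetter_lt_iff, zone_of_fixed rfl, zone_of_fixed rfl] at hlt
      simp only [lt_irrefl, Equiv.Perm.coe_one, id_eq, true_and, false_or] at hlt
      have := Fin.lt_def.mp hlt
      omega
    have hW : permWeight (fun _ => a) 0 0 ((1, fun _ => 0) : ColPerm 1 n) = a ^ n := by
      simp [permWeight, letterWeight]
    simp only [Function.comp, g, hD, hW]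
    rw [h, mul_pow, mul_assoc]
  · rintro ⟨n, σ, ε⟩ hv
    obtain ⟨j, hj⟩ : ∃ j, σ j ≠ j := by
      by_contra! hc
      refine hv ⟨n, ?_⟩
      obtain rfl : σ = 1 := Equiv.ext hc
      obtain rfl : ε = fun _ => 0 := Subsingleton.elim _ _
      rfl
    have hW : permWeight (fun _ => a) 0 0 ((σ, ε) : ColPerm 1 n) = 0 := by
      refine Finset.prod_eq_zero (Finset.mem_univ j) ?_
      simp [letterWeight, hj]
    simp only [hW]
    ring

theorem Ez_neg_mul_Hz (a : A) : Ez (-a) * Hz a = 1 := by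
  have h1 := prod_Ez_mul_pairSum (l := 1) (fun _ => a) 0 0
  rw [← Hz_eq_pairSum, pairSum_zero] at h1
  simpa using h1

theorem constantCoeff_Hz (a : A) : MvPowerSeries.constantCoeff (Hz a) = 1 := by
  have h1 := congrArg MvPowerSeries.constantCoeff (Ez_neg_mul_Hz a)
  rwa [map_mul, constantCoeff_Ez, one_mul, map_one] at h1

/-- The factor of a letter of color `m` in the generating function of the colors. -/
def colorWeight (m : ℕ) : A := if m = 0 then 1 else s m

theorem colorWeight_eq_prod {m : ℕ} (hm : m < l) :
    colorWeight m = ∏ k : Fin (l - 1), if m = k + 1 then s (k + 1) else 1 := by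
  unfold colorWeight
  split_ifs with h0
  · exact (Finset.prod_eq_one fun k _ => if_neg (by omega)).symm
  · rw [Finset.prod_eq_single ⟨m - 1, by omega⟩]
    · have h1 : m - 1 + 1 = m := by omega
      simp [h1]
    · intro k _ hk
      refine if_neg fun hc => hk (Fin.ext ?_)
      simp only; omega
    · simp

theorem permWeight_eq {n : ℕ} (π : ColPerm l n) :
    permWeight (fun m => r m * colorWeight m) t (fun m => colorWeight m) π =
      t ^ exc π * (∏ m : Fin l, r m ^ fixVec π m) *
        ∏ m : Fin (l - 1), s (m + 1) ^ colVec π m := by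
  classical
  have h1 : ∀ j, letterWeight (fun m _ => r m * colorWeight m) t (fun m => colorWeight m) π
      (fun _ => 1) j = (if IsExc π j then t else 1) *
        (∏ m : Fin l, if π.1 j = j ∧ π.2 j = m then r m else 1) *
          ∏ m : Fin (l - 1), if (π.2 j : ℕ) = m + 1 then s (m + 1) else 1 := by
    intro j
    rw [← colorWeight_eq_prod (π.2 j).2, letterWeight]
    by_cases hj : π.1 j = j
    · rw [if_pos hj, if_neg (not_isExc_of_fixed hj), Finset.prod_eq_single (π.2 j)]
      · simp [hj]
      · exact fun m _ hm => if_neg fun hc => hm hc.2.symm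
      · simp
    · rw [if_neg hj, Finset.prod_eq_one fun m _ => if_neg fun hc => hj hc.1, mul_one]
      split_ifs with he
      · rw [((isExc_iff π j).mp he).1]; simp [colorWeight]
      · rw [one_mul]
  have hpow : ∀ (P : Fin n → Prop) [DecidablePred P] (a : A),
      ∏ j, (if P j then a else 1) = a ^ (Finset.univ.filter P).card := fun P _ a => by
    rw [Finset.prod_ite, Finset.prod_const, Finset.prod_const_one, mul_one]
  have h2 : ∏ j, ∏ m : Fin l, (if π.1 j = j ∧ π.2 j = m then r m else (1 : A)) =
      ∏ m : Fin l, r m ^ fixVec π m := by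
    rw [Finset.prod_comm]
    refine Finset.prod_congr rfl fun m _ => (hpow _ _).trans ?_
    unfold fixVec; congr
  have h3 : ∏ j, ∏ m : Fin (l - 1), (if (π.2 j : ℕ) = m + 1 then s (m + 1) else (1 : A)) =
      ∏ m : Fin (l - 1), s (m + 1) ^ colVec π m := by
    rw [Finset.prod_comm]
    refine Finset.prod_congr rfl fun m _ => (hpow _ _).trans ?_
    unfold colVec; congr
  rw [permWeight, Finset.prod_congr rfl fun j _ => h1 j, Finset.prod_mul_distrib,
    Finset.prod_mul_distrib, hpow, h2, h3]
  simp only [exc]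

theorem hasSum_Q : HasSum
    (fun p : ℕ × ℕ × (Fin l → ℕ) × (Fin (l - 1) → ℕ) =>
      Q l p.1 p.2.1 p.2.2.1 p.2.2.2 * z ^ p.1 * t ^ p.2.1 *
        (∏ m : Fin l, r m ^ p.2.2.1 m) * ∏ m : Fin (l - 1), s (m + 1) ^ p.2.2.2 m)
    (pairSum (fun (m : Fin l) _ => r m * colorWeight m) t fun m => colorWeight m) := by
  classical
  have h1 := hasSum_permWeight (fun m : Fin l => r m * colorWeight m) t fun m => colorWeight m
  let φ : (Σ n : ℕ, ColPerm l n) → ℕ × ℕ × (Fin l → ℕ) × (Fin (l - 1) → ℕ) :=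
    fun y => (y.1, exc y.2, fixVec y.2, colVec y.2)
  refine ((Equiv.sigmaFiberEquiv φ).hasSum_iff.mpr h1).sigma fun p => ?_
  obtain ⟨n, k, α, β⟩ := p
  let S : Finset (Σ n : ℕ, ColPerm l n) := (Finset.univ.filter fun π : ColPerm l n =>
    exc π = k ∧ fixVec π = α ∧ colVec π = β).map ⟨Sigma.mk n, sigma_mk_injective⟩
  have hS : ∀ y, y ∈ S ↔ φ y = (n, k, α, β) := by
    rintro ⟨n', π⟩
    simp only [S, φ, Finset.mem_map, Finset.mem_filter, Finset.mem_univ, true_and, Prod.mk.injEq,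
      Function.Embedding.coeFn_mk]
    constructor
    · rintro ⟨π', h, h'⟩
      cases h'
      exact ⟨rfl, h⟩
    · rintro ⟨rfl, h⟩
      exact ⟨π, h, rfl⟩
  have h2 : HasSum (fun y : {y // φ y = (n, k, α, β)} =>
      F y.1.1 (DEX y.1.2) * permWeight (fun m : Fin l => r m * colorWeight m) t
        (fun m => colorWeight m) y.1.2 * z ^ y.1.1)
      (∑ y ∈ S, F y.1 (DEX y.2) * permWeight (fun m : Fin l => r m * colorWeight m) t
        (fun m => colorWeight m) y.2 * z ^ y.1) := by
    have := Finset.hasSum S fun y => F y.1 (DEX y.2) * permWeight (fun m : Fin l =>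
      r m * colorWeight m) t (fun m => colorWeight m) y.2 * z ^ y.1
    exact (Equiv.subtypeEquivRight hS).symm.hasSum_iff.mpr this
  have h3 : Q l n k α β * z ^ n * t ^ k * (∏ m : Fin l, r m ^ α m) *
      (∏ m : Fin (l - 1), s (m + 1) ^ β m) =
        ∑ y ∈ S, F y.1 (DEX y.2) * permWeight (fun m : Fin l => r m * colorWeight m) t
          (fun m => colorWeight m) y.2 * z ^ y.1 := by
    simp only [S, Finset.sum_map, Function.Embedding.coeFn_mk, Q, Finset.sum_mul]
    refine Finset.sum_congr rfl fun π hπ => ?_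
    obtain ⟨-, rfl, rfl, rfl⟩ := Finset.mem_filter.mp hπ
    rw [permWeight_eq]
    ring
  simp only [h3]
  exact h2

end Elimination

/-! ### A product formula in the spirit of MacMahon's master theorem -/

section Master

variable {ι R : Type*} [LinearOrder ι] [CommRing R]

/-- A product of shifted initial sums telescopes up to the boundary factors. -/
theorem telescoping_prod (f : ι → R) (c δ : R) (T : Finset ι) :
    (c + δ * ∑ a ∈ T, f a) * ∏ b ∈ T, (c + δ * ∑ a ∈ T with a < b, f a) =
      c * ∏ b ∈ T, (c + δ * ∑ a ∈ T with a < b, f a + δ * f b) := by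
  induction T using Finset.induction_on_max with
  | empty => simp
  | insert m T hm ih =>
    have hmT : m ∉ T := fun h => lt_irrefl _ (hm m h)
    have h1 : (insert m T).filter (· < m) = T := by
      ext a
      simp only [Finset.mem_filter, Finset.mem_insert]
      constructor
      · rintro ⟨rfl | h, h'⟩
        exacts [absurd h' (lt_irrefl _), h]
      · exact fun h => ⟨Or.inr h, hm a h⟩
    have h2 : ∀ b ∈ T, (insert m T).filter (· < b) = T.filter (· < b) := by
      intro b hb
      rw [Finset.filter_insert, if_neg (lt_asymm (hm b hb))]
    have h3 : ∏ b ∈ T, (c + δ * ∑ a ∈ insert m T with a < b, f a) =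
        ∏ b ∈ T, (c + δ * ∑ a ∈ T with a < b, f a) :=
      Finset.prod_congr rfl fun b hb => by rw [h2 b hb]
    have h4 : ∏ b ∈ T, (c + δ * ∑ a ∈ insert m T with a < b, f a + δ * f b) =
        ∏ b ∈ T, (c + δ * ∑ a ∈ T with a < b, f a + δ * f b) :=
      Finset.prod_congr rfl fun b hb => by rw [h2 b hb]
    rw [Finset.prod_insert hmT, Finset.prod_insert hmT, h1, h3, h4, Finset.sum_insert hmT]
    linear_combination (c + δ * (f m + ∑ a ∈ T, f a)) * ih

/-- The substitution `X a ↦ 0` for `a ∉ T`. -/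
def killOutside (T : Finset ι) : MvPolynomial ι R →ₐ[R] MvPolynomial ι R :=
  MvPolynomial.aeval fun a => if a ∈ T then MvPolynomial.X a else 0

theorem coeff_killOutside {T : Finset ι} {c : ι →₀ ℕ} (hc : c.support ⊆ T)
    (P : MvPolynomial ι R) :
    MvPolynomial.coeff c (killOutside T P) = MvPolynomial.coeff c P := by
  induction P using MvPolynomial.induction_on' with
  | add P Q hP hQ => rw [map_add, MvPolynomial.coeff_add, MvPolynomial.coeff_add, hP, hQ]
  | monomial d a =>
    rw [killOutside, MvPolynomial.aeval_monomial]
    by_cases hd : d.support ⊆ T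
    · rw [Finsupp.prod, Finset.prod_congr rfl fun b hb => by rw [if_pos (hd hb)],
        MvPolynomial.monomial_eq]
      rfl
    · obtain ⟨b, hb, hbT⟩ := Finset.not_subset.mp hd
      rw [Finsupp.prod, Finset.prod_eq_zero hb, mul_zero, MvPolynomial.coeff_zero,
        MvPolynomial.coeff_monomial, if_neg]
      · rintro rfl; exact hbT (hc hb)
      · rw [if_neg hbT, zero_pow (Finsupp.mem_support_iff.mp hb)]

/-- The weight of a letter `a` in the block of `b`: excedances (`b ≤ a`) have weight `u`, the
other letters of color zero (`a ≤ b`) have weight `1`, and the letters of positive color, which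
occur without restriction, have total weight `S`. -/
def blockWeight (u S : R) (b a : ι) : R :=
  (if b ≤ a then u else 0) + (if a ≤ b then 1 else 0) + S

variable (u S : R)

/-- The generating polynomial of the letters in the block of `b`, over the alphabet `T`. -/
def blockForm (T : Finset ι) (b : ι) : MvPolynomial ι R :=
  ∑ a ∈ T, MvPolynomial.C (blockWeight u S b a) * MvPolynomial.X a

/-- The generating polynomial of the words of length `c b` in the block of `b`, where for `b ∈ U`
the weight of the first letter is reduced by `e` if this letter is `b`. -/
def blockFactor (e : R) (T U : Finset ι) (c : ι →₀ ℕ) (b : ι) : MvPolynomial ι R :=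
  if c b = 0 then 1 else blockForm u S T b ^ (c b - 1) *
    if b ∈ U then blockForm u S T b - MvPolynomial.C e * MvPolynomial.X b else blockForm u S T b

/-- The generating function, by content, of the families of block words in which every letter
occurs as often as its block is long. -/
def circuitSeries (e : R) (U : Finset ι) : MvPowerSeries ι R := fun c =>
  MvPolynomial.coeff c (∏ b ∈ c.support, blockFactor u S e c.support U c b)

/-- The same with reduced weight of the first letter in all blocks. -/
def circuitSeriesAll (e : R) : MvPowerSeries ι R := fun c =>
  MvPolynomial.coeff c (∏ b ∈ c.support, blockFactor u S e c.support c.support c b)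

theorem killOutside_blockForm {T T' : Finset ι} (h : T' ⊆ T) (b : ι) :
    killOutside T' (blockForm u S T b) = blockForm u S T' b := by
  rw [blockForm, blockForm, map_sum, ← Finset.sum_subset h]
  · refine Finset.sum_congr rfl fun a ha => ?_
    rw [map_mul, killOutside, MvPolynomial.aeval_X, if_pos ha, MvPolynomial.algHom_C]
    rfl
  · intro a _ ha
    rw [map_mul, killOutside, MvPolynomial.aeval_X, if_neg ha, mul_zero]

theorem killOutside_blockFactor (e : R) {T T' : Finset ι} (h : T' ⊆ T) (U : Finset ι)
    (c : ι →₀ ℕ) {b : ι} (hb : b ∈ T') :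
    killOutside T' (blockFactor u S e T U c b) = blockFactor u S e T' U c b := by
  have h1 : killOutside T' (MvPolynomial.C e * MvPolynomial.X b) =
      (MvPolynomial.C e * MvPolynomial.X b : MvPolynomial ι R) := by
    rw [map_mul, killOutside, MvPolynomial.aeval_X, if_pos hb, MvPolynomial.algHom_C]
    rfl
  unfold blockFactor
  split_ifs <;> simp only [map_one, map_mul, map_pow, map_sub, killOutside_blockForm u S h, h1]

theorem circuitSeries_eq (e : R) (U : Finset ι) {T : Finset ι} {c : ι →₀ ℕ}
    (hc : c.support ⊆ T) : circuitSeries u S e U c =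
      MvPolynomial.coeff c (∏ b ∈ T, blockFactor u S e T U c b) := by
  have h1 : ∏ b ∈ T, blockFactor u S e T U c b = ∏ b ∈ c.support, blockFactor u S e T U c b := by
    refine (Finset.prod_subset hc fun b _ hb => ?_).symm
    rw [blockFactor, if_pos (by simpa using hb)]
  rw [h1, ← coeff_killOutside subset_rfl, map_prod,
    Finset.prod_congr rfl fun b hb => killOutside_blockFactor u S e hc U c hb]
  rfl

theorem one_sub_mul_circuitSeries (e : R) {U : Finset ι} {b : ι} (hb : b ∉ U) :
    (1 - MvPowerSeries.monomial (Finsupp.single b 1) e) * circuitSeries u S e U =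
      circuitSeries u S e (insert b U) := by
  ext c
  rw [sub_mul, one_mul, map_sub, MvPowerSeries.coeff_monomial_mul]
  by_cases hcb : c b = 0
  · rw [if_neg (fun h => by simpa [hcb] using h b), sub_zero]
    change MvPolynomial.coeff c _ = MvPolynomial.coeff c _
    congr 1
    refine Finset.prod_congr rfl fun b' hb' => ?_
    have : b' ≠ b := by rintro rfl; simp [hcb] at hb'
    simp [blockFactor, this]
  · have hle : Finsupp.single b 1 ≤ c := by
      rw [Finsupp.single_le_iff]; omega
    rw [if_pos hle]
    set c' := c - Finsupp.single b 1 with hc'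
    have hcc' : c = Finsupp.single b 1 + c' := (add_tsub_cancel_of_le hle).symm
    have hsupp : c'.support ⊆ c.support := by
      intro a ha
      simp only [hc', Finsupp.mem_support_iff, Finsupp.coe_tsub, Pi.sub_apply] at ha ⊢
      omega
    have hbs : b ∈ c.support := Finsupp.mem_support_iff.mpr hcb
    have hc'b : c' b = c b - 1 := by simp [hc']
    have hc'a : ∀ a, a ≠ b → c' a = c a := fun a ha => by
      simp [hc', Finsupp.single_eq_of_ne ha]
    change circuitSeries u S e U c - e * circuitSeries u S e U c' =
      circuitSeries u S e (insert b U) c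
    rw [circuitSeries_eq u S e U (subset_refl c.support), circuitSeries_eq u S e U hsupp,
      circuitSeries_eq u S e (insert b U) (subset_refl c.support)]
    rw [← Finset.mul_prod_erase _ _ hbs, ← Finset.mul_prod_erase _ _ hbs,
      ← Finset.mul_prod_erase (a := b) c.support
        (fun b' => blockFactor u S e _ (insert b U) c b') hbs]
    have hE1 : ∏ b' ∈ c.support.erase b, blockFactor u S e c.support U c' b' =
        ∏ b' ∈ c.support.erase b, blockFactor u S e c.support U c b' :=
      Finset.prod_congr rfl fun b' hb' => by
        rw [blockFactor, blockFactor, hc'a b' (Finset.ne_of_mem_erase hb')]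
    have hE2 : ∏ b' ∈ c.support.erase b, blockFactor u S e c.support (insert b U) c b' =
        ∏ b' ∈ c.support.erase b, blockFactor u S e c.support U c b' :=
      Finset.prod_congr rfl fun b' hb' => by
        have := Finset.ne_of_mem_erase hb'
        simp [blockFactor, this]
    rw [hE1, hE2]
    set E := ∏ b' ∈ c.support.erase b, blockFactor u S e c.support U c b'
    have hf1 : blockFactor u S e c.support U c' b = blockForm u S c.support b ^ (c b - 1) := by
      rw [blockFactor, hc'b, if_neg hb]
      split_ifs with h0
      · rw [h0, pow_zero]
      · rw [← pow_succ]; congr 1; omega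
    have hf2 : blockFactor u S e c.support U c b =
        blockForm u S c.support b ^ (c b - 1) * blockForm u S c.support b := by
      rw [blockFactor, if_neg hcb, if_neg hb]
    have hf3 : blockFactor u S e c.support (insert b U) c b =
        blockForm u S c.support b ^ (c b - 1) *
          (blockForm u S c.support b - MvPolynomial.C e * MvPolynomial.X b) := by
      rw [blockFactor, if_neg hcb, if_pos (Finset.mem_insert_self _ _)]
    rw [hf1, hf2, hf3]
    have hcoeff : ∀ P : MvPolynomial ι R, MvPolynomial.coeff c (MvPolynomial.X b * P) =
        MvPolynomial.coeff c' P := fun P => by rw [hcc', MvPolynomial.coeff_X_mul]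
    have hX : e * MvPolynomial.coeff c' (blockForm u S c.support b ^ (c b - 1) * E) =
        MvPolynomial.coeff c (MvPolynomial.C e * (MvPolynomial.X b *
          (blockForm u S c.support b ^ (c b - 1) * E))) := by
      rw [MvPolynomial.coeff_C_mul, hcoeff]
    rw [hX, ← MvPolynomial.coeff_sub]
    congr 1
    ring

theorem prod_one_sub_mul_circuitSeries (e : R) (U : Finset ι) :
    (∏ b ∈ U, (1 - MvPowerSeries.monomial (Finsupp.single b 1) e)) * circuitSeries u S e ∅ =
      circuitSeries u S e U := by
  induction U using Finset.induction_on with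
  | empty => simp
  | insert b U hb ih =>
    rw [Finset.prod_insert hb, mul_assoc, ih, one_sub_mul_circuitSeries u S e hb]

theorem circuitSeries_empty (e e' : R) :
    circuitSeries (ι := ι) u S e ∅ = circuitSeries u S e' ∅ := by
  funext c
  unfold circuitSeries
  refine congrArg (MvPolynomial.coeff c) (Finset.prod_congr rfl fun b _ => ?_)
  simp only [blockFactor, Finset.notMem_empty, if_false]

theorem circuitSeries_of_subset (e : R) {U : Finset ι} {c : ι →₀ ℕ} (hc : c.support ⊆ U) :
    circuitSeries u S e U c = circuitSeriesAll u S e c := by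
  change MvPolynomial.coeff c _ = MvPolynomial.coeff c _
  congr 1
  refine Finset.prod_congr rfl fun b hb => ?_
  simp only [blockFactor, hb, hc hb]

/-- The two reductions `e = 1` and `e = u` lead to proportional coefficients, since the products
of the reduced first letters telescope. -/
theorem circuitSeriesAll_relation [IsDomain R] :
    MvPowerSeries.C (1 + S) * circuitSeriesAll (ι := ι) u S 1 -
      MvPowerSeries.C (u + S) * circuitSeriesAll u S u = MvPowerSeries.C (1 - u) := by
  ext c
  rw [map_sub, MvPowerSeries.coeff_C_mul, MvPowerSeries.coeff_C_mul, MvPowerSeries.coeff_C]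
  change (1 + S) * circuitSeriesAll u S 1 c - (u + S) * circuitSeriesAll u S u c = _
  split_ifs with hc
  · subst hc
    simp [circuitSeriesAll]
  · set T := c.support with hT
    have hTne : T.Nonempty := Finsupp.support_nonempty_iff.mpr hc
    have hform : ∀ b ∈ T, blockForm u S T b - MvPolynomial.X b =
        MvPolynomial.C (u + S) * ∑ a ∈ T, MvPolynomial.X a +
          MvPolynomial.C (1 - u) * ∑ a ∈ T with a < b, MvPolynomial.X a := by
      intro b hb
      have h1 : (MvPolynomial.X b : MvPolynomial ι R) =
          ∑ a ∈ T, if a = b then MvPolynomial.X a else 0 := by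
        rw [Finset.sum_ite_eq' T b, if_pos hb]
      rw [h1, blockForm, Finset.sum_filter, Finset.mul_sum, Finset.mul_sum,
        ← Finset.sum_sub_distrib, ← Finset.sum_add_distrib]
      refine Finset.sum_congr rfl fun a _ => ?_
      unfold blockWeight
      rcases lt_trichotomy a b with h | h | h
      · simp only [h.not_ge, h.le, h, h.ne, if_true, if_false, map_add, map_sub, map_one, map_zero]
        ring
      · subst h
        simp only [le_refl, lt_irrefl, if_true, if_false, map_add, map_sub, map_one]
        ring
      · simp only [h.not_ge, h.le, h.ne', h.not_gt, if_true, if_false, map_add, map_sub, map_one,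
          map_zero]
        ring
    have htel := telescoping_prod (fun a => (MvPolynomial.X a : MvPolynomial ι R))
      (MvPolynomial.C (u + S) * ∑ a ∈ T, MvPolynomial.X a) (MvPolynomial.C (1 - u)) T
    have hprod1 : ∏ b ∈ T, blockFactor u S 1 T T c b =
        (∏ b ∈ T, blockForm u S T b ^ (c b - 1)) *
          ∏ b ∈ T, (MvPolynomial.C (u + S) * ∑ a ∈ T, MvPolynomial.X a +
          MvPolynomial.C (1 - u) * ∑ a ∈ T with a < b, MvPolynomial.X a) := by
      rw [← Finset.prod_mul_distrib]
      refine Finset.prod_congr rfl fun b hb => ?_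
      rw [blockFactor, if_neg (Finsupp.mem_support_iff.mp hb), if_pos hb, map_one, one_mul,
        hform b hb]
    have hprodu : ∏ b ∈ T, blockFactor u S u T T c b =
        (∏ b ∈ T, blockForm u S T b ^ (c b - 1)) *
          ∏ b ∈ T, (MvPolynomial.C (u + S) * ∑ a ∈ T, MvPolynomial.X a +
          MvPolynomial.C (1 - u) * ∑ a ∈ T with a < b, MvPolynomial.X a +
            MvPolynomial.C (1 - u) * MvPolynomial.X b) := by
      rw [← Finset.prod_mul_distrib]
      refine Finset.prod_congr rfl fun b hb => ?_
      rw [blockFactor, if_neg (Finsupp.mem_support_iff.mp hb), if_pos hb, ← hform b hb, map_sub,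
        map_one]
      ring
    have hne : (∑ a ∈ T, MvPolynomial.X a : MvPolynomial ι R) ≠ 0 := by
      obtain ⟨a, ha⟩ := hTne
      intro h0
      have := congrArg (MvPolynomial.coeff (Finsupp.single a 1)) h0
      rw [MvPolynomial.coeff_sum, Finset.sum_eq_single a] at this
      · simp at this
      · intro b _ hb
        rw [MvPolynomial.coeff_X, if_neg]
        exact fun h => hb (Finsupp.single_left_injective one_ne_zero h)
      · exact fun h => absurd ha h
    have key : MvPolynomial.C (1 + S) * ∏ b ∈ T, blockFactor u S 1 T T c b =
        MvPolynomial.C (u + S) * ∏ b ∈ T, blockFactor u S u T T c b := by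
      refine mul_left_cancel₀ hne ?_
      rw [hprod1, hprodu]
      simp only [map_add, map_sub, map_one] at htel ⊢
      linear_combination (∏ b ∈ T, blockForm u S T b ^ (c b - 1)) * htel
    have := congrArg (MvPolynomial.coeff c) key
    rw [MvPolynomial.coeff_C_mul, MvPolynomial.coeff_C_mul] at this
    exact sub_eq_zero.mpr this

end Master

/-! ### Contents of sequences -/

section Content

variable {n : ℕ}

/-- The content of a sequence counts how often each value occurs. -/
def content (a : Fin n → ℕ+) : ℕ+ →₀ ℕ := ∑ k, Finsupp.single (a k) 1

theorem content_apply (a : Fin n → ℕ+) (b : ℕ+) :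
    content a b = (Finset.univ.filter fun k => a k = b).card := by
  rw [content, Finsupp.finsetSum_apply, Finset.card_filter]
  refine Finset.sum_congr rfl fun k _ => ?_
  rw [Finsupp.single_apply]

theorem content_comp_perm (a : Fin n → ℕ+) (σ : Equiv.Perm (Fin n)) :
    content (a ∘ σ) = content a := Equiv.sum_comp σ fun k => Finsupp.single (a k) 1

theorem mem_support_content (a : Fin n → ℕ+) (k : Fin n) : a k ∈ (content a).support := by
  rw [Finsupp.mem_support_iff, content_apply]
  exact (Finset.card_pos.mpr ⟨k, by simp⟩).ne'

theorem degree_content (a : Fin n → ℕ+) : (content a).degree = n := by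
  rw [content, map_sum]
  simp

theorem toMultiset_content (a : Fin n → ℕ+) :
    Finsupp.toMultiset (content a) = (List.ofFn a : Multiset ℕ+) := by
  rw [content, map_sum]
  simp only [Finsupp.toMultiset_single, one_smul]
  induction n with
  | zero => simp
  | succ n ih => rw [Fin.sum_univ_succ, ih, List.ofFn_succ, ← Multiset.cons_coe,
      Multiset.singleton_add]

theorem eq_of_antitone_of_content_eq {i i' : Fin n → ℕ+} (hi : Antitone i) (hi' : Antitone i')
    (h : content i = content i') : i = i' := by
  have h1 := congrArg Finsupp.toMultiset h
  rw [toMultiset_content, toMultiset_content, Multiset.coe_eq_coe] at h1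
  exact List.ofFn_injective (h1.eq_of_sortedGE hi.sortedGE_ofFn hi'.sortedGE_ofFn)

theorem exists_antitone_content (c : ℕ+ →₀ ℕ) :
    ∃ (n : ℕ) (i : Fin n → ℕ+), Antitone i ∧ content i = c := by
  obtain ⟨n, a, ha⟩ : ∃ (n : ℕ) (a : Fin n → ℕ+), content a = c := by
    induction c using Finsupp.induction_linear with
    | zero => exact ⟨0, Fin.elim0, rfl⟩
    | add c c' h h' =>
      obtain ⟨n, a, rfl⟩ := h
      obtain ⟨n', a', rfl⟩ := h'
      refine ⟨n + n', Fin.append a a', ?_⟩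
      simp [content, Fin.sum_univ_add]
    | single b k => exact ⟨k, fun _ => b, by simp [content]⟩
  refine ⟨n, a ∘ Tuple.sort (OrderDual.toDual ∘ a), ?_, by rw [content_comp_perm, ha]⟩
  exact Tuple.monotone_sort (OrderDual.toDual ∘ a)

end Content

/-! ### Compatible pairs as words -/

section Encoding

variable {n : ℕ}

/-- The letters of a word, ordered by decreasing value and increasing class. -/
def letterKey (w : Fin n → ℕ+ × ℕ) (k : Fin n) : ℕ+ᵒᵈ ×ₗ ℕ :=
  toLex (OrderDual.toDual (w k).1, (w k).2)

theorem eq_sort_letterKey_iff (σ : Equiv.Perm (Fin n)) (w : Fin n → ℕ+ × ℕ) :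
    σ = Tuple.sort (letterKey w) ↔
      ∀ j j', j < j' → Precedes σ (fun j => (w (σ j)).2) (fun j => (w (σ j)).1) j j' := by
  have hle : ∀ j j', letterKey w (σ j) ≤ letterKey w (σ j') ↔ (w (σ j')).1 < (w (σ j)).1 ∨
      ((w (σ j)).1 = (w (σ j')).1 ∧ (w (σ j)).2 ≤ (w (σ j')).2) := fun j j' => by
    unfold letterKey
    rw [Prod.Lex.toLex_le_toLex]
    simp only [OrderDual.toDual_lt_toDual, OrderDual.toDual_inj]
  have heq : ∀ j j', letterKey w (σ j) = letterKey w (σ j') ↔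
      (w (σ j)).1 = (w (σ j')).1 ∧ (w (σ j)).2 = (w (σ j')).2 := fun j j' => by
    unfold letterKey
    rw [toLex_inj, Prod.mk.injEq, OrderDual.toDual_inj]
  rw [Tuple.eq_sort_iff]
  simp only [heq]
  unfold Precedes
  constructor
  · rintro ⟨h1, h2⟩ j j' hj
    rcases (hle j j').mp (h1 hj.le) with h3 | ⟨h3, h4⟩
    · exact Or.inl h3
    · refine Or.inr ⟨h3, ?_⟩
      rcases h4.lt_or_eq with h5 | h5
      · exact Or.inl h5
      · exact Or.inr ⟨h5, h2 j j' hj ⟨h3, h5⟩⟩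
  · intro h
    refine ⟨fun j j' hj => (hle j j').mpr ?_, fun j j' hj h3 => ?_⟩
    · rcases hj.eq_or_lt with rfl | hj
      · exact Or.inr ⟨rfl, le_rfl⟩
      · rcases h j j' hj with h3 | ⟨h3, h4⟩
        · exact Or.inl h3
        · exact Or.inr ⟨h3, h4.elim le_of_lt fun h5 => h5.1.le⟩
    · rcases h j j' hj with h4 | ⟨-, h4 | h4⟩
      exacts [absurd h3.1 h4.ne', absurd h3.2 h4.ne, h4.2]

variable {l : ℕ}

/-- The word of a compatible pair: its letter at the value `π j` consists of the index and the
class of the position `j`. -/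
def pairWord (v : CompatiblePair l) : Σ n : ℕ, Fin n → ℕ+ × ℕ :=
  ⟨v.1, fun k => (v.2.1.2 (v.2.1.1.1.symm k), zone v.2.1.1 (v.2.1.1.1.symm k))⟩

theorem color_eq_of_zone_eq {π π' : ColPerm l n} {j : Fin n}
    (h : zone π j = zone π' j) : π.2 j = π'.2 j := by
  have h2 := (π.2 j).2
  have h3 := (π'.2 j).2
  unfold zone at h
  apply Fin.ext
  split_ifs at h with h4 h5 h5
  · rw [((isExc_iff _ _).mp h4).1, ((isExc_iff _ _).mp h5).1]
  · omega
  · omega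
  · omega

theorem pairWord_injective : Function.Injective (pairWord (l := l)) := by
  rintro ⟨n, ⟨⟨⟨σ, ε⟩, i⟩, h⟩⟩ ⟨n', ⟨⟨⟨σ', ε'⟩, i'⟩, h'⟩⟩ heq
  obtain rfl : n = n' := congrArg Sigma.fst heq
  simp only [pairWord, Sigma.mk.injEq, heq_eq_eq, true_and] at heq
  have key : ∀ {σ : Equiv.Perm (Fin n)} {ε : Fin n → Fin l} {i : Fin n → ℕ+},
      IsCompatible (σ, ε) i → σ = Tuple.sort (letterKey fun k =>
        (i (σ.symm k), zone (σ, ε) (σ.symm k))) := by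
    intro σ ε i h
    rw [eq_sort_letterKey_iff]
    simp only [Equiv.symm_apply_apply]
    exact h
  obtain rfl : σ = σ' := by rw [key h, key h', heq]
  have h1 : ∀ j, i j = i' j ∧ zone (σ, ε) j = zone (σ, ε') j := fun j => by
    simpa using congrFun heq (σ j)
  obtain rfl : i = i' := funext fun j => (h1 j).1
  obtain rfl : ε = ε' := funext fun j =>
    color_eq_of_zone_eq (π := (σ, ε)) (π' := (σ, ε')) (h1 j).2
  rfl

/-- A letter `p` is admissible at position `k` of the block structure `i`: an excedance is at
least `i k`, with equality excluded at the first position of a block, another letter of color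
zero is at most `i k`, and there is no condition on the letters of positive color. -/
def IsAdmissible (l : ℕ) (i : Fin n → ℕ+) (k : Fin n) (p : ℕ+ × ℕ) : Prop :=
  p.2 ≤ l ∧ (p.2 = 0 → i k ≤ p.1 ∧ ¬ (p.1 = i k ∧ ∀ k' < k, i k' ≠ i k)) ∧ (p.2 = l → p.1 ≤ i k)

theorem IsCompatible.isAdmissible {π : ColPerm l n} {i : Fin n → ℕ+} (h : IsCompatible π i)
    (k : Fin n) : IsAdmissible l i k (i (π.1.symm k), zone π (π.1.symm k)) := by
  obtain ⟨j, rfl⟩ := π.1.surjective k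
  rw [Equiv.symm_apply_apply]
  have h0 := (π.2 j).2
  have hanti := antitone_of_precedes h
  by_cases hj : IsExc π j
  · have h1 := ((isExc_iff π j).mp hj).2
    have h2 : zone π j = 0 := by rw [zone, if_pos hj]
    refine ⟨by simp only; omega, fun _ => ⟨hanti h1.le, fun hc => hc.2 j h1 hc.1⟩,
      fun hc => ?_⟩
    simp only at hc
    omega
  · have h2 : zone π j = l - π.2 j := by rw [zone, if_neg hj]
    refine ⟨by simp only; omega, fun hc => ?_, fun hc => ?_⟩
    · simp only at hc
      omega
    · simp only at hc
      have h3 : (π.2 j : ℕ) = 0 := by omega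
      exact hanti (not_lt.mp fun h4 => hj ((isExc_iff π j).mpr ⟨h3, h4⟩))

/-- A word with admissible letters is the word of a compatible pair: the excedances of a block
come first, the other letters of color zero come last, and along each of these two classes the
difference of value and position is monotone, so that admissibility at the ends suffices. -/
theorem exists_pairWord_eq (hl : 0 < l) {i : Fin n → ℕ+} (hi : Antitone i)
    {w : Fin n → ℕ+ × ℕ} (hw : ∀ k, IsAdmissible l i k (w k))
    (hc : content (fun k => (w k).1) = content i) :
    ∃ v : CompatiblePair l, pairWord v = ⟨n, w⟩ := by
  set σ := Tuple.sort (letterKey w) with hσ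
  have hprec := (eq_sort_letterKey_iff σ w).mp hσ
  obtain rfl : (fun j => (w (σ j)).1) = i :=
    eq_of_antitone_of_content_eq (antitone_of_precedes hprec) hi
      ((content_comp_perm (fun k => (w k).1) σ).trans hc)
  set i : Fin n → ℕ+ := fun j => (w (σ j)).1 with hidef
  set ζ : Fin n → ℕ := fun j => (w (σ j)).2 with hζdef
  have hexc : ∀ j, ζ j = 0 → j < σ j := by
    intro j hj
    obtain ⟨h1, h2⟩ := (hw (σ j)).2.1 hj
    change i (σ j) ≤ i j at h1
    rcases h1.lt_or_eq with h1 | h1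
    · exact lt_of_not_ge fun hle => absurd (hi hle) h1.not_ge
    · -- the first position `p` of the block is an excedance, and `σ p - p ≤ σ j - j`
      have hne : (Finset.univ.filter fun p => i p = i j).Nonempty := ⟨j, by simp⟩
      set p := Finset.min' _ hne with hp
      have hp1 : i p = i j := by simpa using Finset.min'_mem _ hne
      have hp2 : ∀ q, i q = i j → p ≤ q := fun q hq => Finset.min'_le _ q (by simpa using hq)
      have hz : ζ p = 0 := by
        have := zone_mono_of_precedes hprec (hp2 j rfl) hp1
        omega
      have hgap := gap_of_precedes hprec (hp2 j rfl) hp1 (hz.trans hj.symm)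
      have hp3 : p < σ p := by
        obtain ⟨h3, h4⟩ := (hw (σ p)).2.1 hz
        change i (σ p) ≤ i p at h3
        change ¬ (i p = i (σ p) ∧ _) at h4
        by_contra hle
        have h5 : i (σ p) = i p := le_antisymm h3 (hi (not_lt.mp hle))
        refine h4 ⟨h5.symm, fun k' hk' hk => ?_⟩
        have h6 := hp2 k' (hk.trans (h5.trans hp1))
        exact hle (lt_of_le_of_lt h6 hk')
      have := hp2 j rfl
      rw [Fin.lt_def] at hp3 ⊢
      rw [Fin.le_def] at this
      omega
  have hnexc : ∀ j, ζ j = l → σ j ≤ j := by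
    intro j hj
    have h1 := (hw (σ j)).2.2 hj
    change i j ≤ i (σ j) at h1
    rcases h1.lt_or_eq with h1 | h1
    · exact le_of_not_gt fun hle => absurd (hi hle.le) h1.not_ge
    · -- the last position `q` of the block satisfies `σ q ≤ q`, and `σ j - j ≤ σ q - q`
      have hne : (Finset.univ.filter fun p => i p = i j).Nonempty := ⟨j, by simp⟩
      set q := Finset.max' _ hne with hq
      have hq1 : i q = i j := by simpa using Finset.max'_mem _ hne
      have hq2 : ∀ p, i p = i j → p ≤ q := fun p hp => Finset.le_max' _ p (by simpa using hp)
      have hz : ζ q = l := by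
        have h2 := zone_mono_of_precedes hprec (hq2 j rfl) hq1.symm
        have h3 := (hw (σ q)).1
        change ζ q ≤ l at h3
        omega
      have hgap := gap_of_precedes hprec (hq2 j rfl) hq1.symm (hj.trans hz.symm)
      have hq3 : σ q ≤ q := by
        have h3 := (hw (σ q)).2.2 hz
        change i q ≤ i (σ q) at h3
        by_contra hlt
        have h4 : i (σ q) = i q := le_antisymm (hi (not_le.mp hlt).le) h3
        exact hlt (hq2 _ (h4.trans hq1))
      have := hq2 j rfl
      rw [Fin.le_def] at hq3 this ⊢
      omega
  let π : ColPerm l n := (σ, fun j => ⟨if ζ j = 0 then 0 else l - ζ j, by split_ifs <;> omega⟩)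
  have hzone : ∀ j, zone π j = ζ j := by
    intro j
    have hle : ζ j ≤ l := (hw (σ j)).1
    have hE : IsExc π j ↔ ζ j = 0 := by
      rw [isExc_iff]
      simp only [π]
      constructor
      · rintro ⟨h1, h2⟩
        by_contra h3
        rw [if_neg h3] at h1
        exact h2.not_ge (hnexc j (by omega))
      · intro h1
        exact ⟨if_pos h1, hexc j h1⟩
    unfold zone
    split_ifs with h1
    · exact (hE.mp h1).symm
    · rw [hE] at h1
      simp only [π, if_neg h1]
      omega
  refine ⟨⟨n, ⟨(π, i), fun j j' hj => ?_⟩⟩, ?_⟩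
  · have := hprec j j' hj
    rwa [show zone π = ζ from funext hzone]
  · simp only [pairWord, hzone]
    congr 1
    funext k
    simp [i, ζ, π]

end Encoding

/-! ### The pairs with a given content -/

/-- The weight of the letters of class `k`, see `zone`: `t` for excedances and the weight of the
color `l - k` otherwise. -/
def classWeight (l k : ℕ) : A := if k = 0 then t else colorWeight (l - k)

open Classical in
/-- The generating polynomial of the letters that are admissible at `k`. -/
theorem sum_admissible {l n : ℕ} (hl : 0 < l) (i : Fin n → ℕ+) (k : Fin n) {T : Finset ℕ+}
    (hT : i k ∈ T) :
    ∑ p ∈ T ×ˢ Finset.range (l + 1) with IsAdmissible l i k p,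
        MvPolynomial.C (classWeight l p.2) * (MvPolynomial.X p.1 : MvPolynomial ℕ+ A) =
      if ∀ k' < k, i k' ≠ i k then
        blockForm t (∑ m ∈ Finset.Ico 1 l, s m) T (i k) -
          MvPolynomial.C t * MvPolynomial.X (i k)
      else blockForm t (∑ m ∈ Finset.Ico 1 l, s m) T (i k) := by
  obtain ⟨l, rfl⟩ := Nat.exists_eq_add_of_lt hl
  rw [zero_add] at *
  have hmid : ∑ m ∈ Finset.range l, classWeight (l + 1) (m + 1) =
      ∑ m ∈ Finset.Ico 1 (l + 1), s m := by
    rw [Finset.sum_Ico_eq_sum_range, Nat.add_sub_cancel, ← Finset.sum_range_reflect]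
    refine Finset.sum_congr rfl fun m hm => ?_
    have := Finset.mem_range.mp hm
    have h1 : l + 1 - (l - 1 - m + 1) = 1 + m := by omega
    rw [classWeight, if_neg (by omega), h1, colorWeight, if_neg (by omega)]
  set S := ∑ m ∈ Finset.Ico 1 (l + 1), s m
  set first := ∀ k' < k, i k' ≠ i k
  have hin : ∀ a, (∑ q ∈ Finset.range (l + 1 + 1),
      if IsAdmissible (l + 1) i k (a, q) then classWeight (l + 1) q else 0) =
        blockWeight t S (i k) a - if a = i k ∧ first then t else 0 := by
    intro a
    rw [Finset.sum_range_succ, Finset.sum_range_succ', ← hmid]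
    have h1 : ∀ m ∈ Finset.range l, (if IsAdmissible (l + 1) i k (a, m + 1) then
        classWeight (l + 1) (m + 1) else 0) = classWeight (l + 1) (m + 1) := by
      intro m hm
      have := Finset.mem_range.mp hm
      exact if_pos ⟨by simp only; omega, by simp, by simp only; omega⟩
    have h2 : IsAdmissible (l + 1) i k (a, 0) ↔ i k ≤ a ∧ ¬ (a = i k ∧ first) :=
      ⟨fun h => h.2.1 rfl, fun h => ⟨Nat.zero_le _, fun _ => h, fun hc => absurd hc (by simp)⟩⟩
    have h3 : IsAdmissible (l + 1) i k (a, l + 1) ↔ a ≤ i k := by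
      simp [IsAdmissible]
    have h4 : classWeight (l + 1) 0 = t := if_pos rfl
    have h5 : classWeight (l + 1) (l + 1) = 1 := by simp [classWeight, colorWeight]
    rw [Finset.sum_congr rfl h1, h4, h5, blockWeight]
    simp only [h2, h3]
    by_cases hf : a = i k ∧ first
    · simp only [hf, not_true, and_false, if_true, if_false, le_refl, and_self]
      ring
    · simp only [hf, not_false_iff, and_true, if_false]
      ring
  have h6 : (if first then blockForm t S T (i k) - MvPolynomial.C t * MvPolynomial.X (i k)
      else blockForm t S T (i k)) = ∑ a ∈ T, MvPolynomial.C (blockWeight t S (i k) a -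
        if a = i k ∧ first then t else 0) * MvPolynomial.X a := by
    simp only [map_sub, sub_mul, Finset.sum_sub_distrib]
    split_ifs with hf
    · rw [Finset.sum_eq_single (i k)
        (f := fun a => MvPolynomial.C (if a = i k ∧ first then t else 0) * MvPolynomial.X a)]
      · simp [hf, blockForm]
      · intro a _ ha
        simp [ha]
      · exact fun h => absurd hT h
    · simp [hf, blockForm]
  rw [h6, Finset.sum_filter, Finset.sum_product]
  refine Finset.sum_congr rfl fun a _ => ?_
  rw [← hin, map_sum, Finset.sum_mul]
  refine Finset.sum_congr rfl fun q _ => ?_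
  split_ifs <;> simp

/-- A product over the positions, grouped by blocks; the first position of each block contributes
the factor `g`. -/
theorem prod_blocks {M : Type*} [CommMonoid M] {n : ℕ} (i : Fin n → ℕ+) (f g : ℕ+ → M) :
    (∏ k, if ∀ k' < k, i k' ≠ i k then g (i k) else f (i k)) =
      ∏ b ∈ (content i).support, (f b ^ (content i b - 1) * g b) := by
  rw [← Finset.prod_fiberwise_of_maps_to (t := (content i).support) (g := i)
    fun k _ => mem_support_content i k]
  refine Finset.prod_congr rfl fun b hb => ?_
  have hcard := content_apply i b
  have hne : (Finset.univ.filter fun k => i k = b).Nonempty := by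
    rw [← Finset.card_pos, ← hcard]
    exact Nat.pos_of_ne_zero (Finsupp.mem_support_iff.mp hb)
  set P := Finset.univ.filter fun k => i k = b
  have hmem : ∀ k, k ∈ P ↔ i k = b := fun k => by simp [P]
  have hmin := Finset.min'_mem P hne
  have h1 := (hmem _).mp hmin
  rw [← Finset.mul_prod_erase P _ hmin, if_pos, h1, mul_comm, hcard,
    ← Finset.card_erase_of_mem hmin, ← Finset.prod_const]
  · congr 1
    refine Finset.prod_congr rfl fun k hk => ?_
    obtain ⟨hk1, hk2⟩ := Finset.mem_erase.mp hk
    rw [if_neg, (hmem k).mp hk2]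
    exact fun h => h _ (lt_of_le_of_ne (Finset.min'_le P k hk2) (Ne.symm hk1))
      (h1.trans ((hmem k).mp hk2).symm)
  · intro k' hk' hc
    exact hk'.not_ge (Finset.min'_le P k' ((hmem k').mpr (hc.trans h1)))

/-- The product of the class weights of the letters of a word. -/
def classProd (l : ℕ) {n : ℕ} (w : Fin n → ℕ+ × ℕ) : A := ∏ k, classWeight l (w k).2

open Classical in
/-- The coefficients of the series `circuitSeriesAll` enumerate the admissible words. -/
theorem circuitSeriesAll_content {l n : ℕ} (hl : 0 < l) (i : Fin n → ℕ+) :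
    circuitSeriesAll t (∑ m ∈ Finset.Ico 1 l, s m) t (content i) =
      ∑ w ∈ Fintype.piFinset (fun k => ((content i).support ×ˢ Finset.range (l + 1)).filter
        (IsAdmissible l i k)) with content (fun k => (w k).1) = content i, classProd l w := by
  set T := (content i).support
  set S := ∑ m ∈ Finset.Ico 1 l, s m
  have h1 : ∏ b ∈ T, blockFactor t S t T T (content i) b =
      ∏ k, ∑ p ∈ T ×ˢ Finset.range (l + 1) with IsAdmissible l i k p,
        MvPolynomial.C (classWeight l p.2) * (MvPolynomial.X p.1 : MvPolynomial ℕ+ A) := by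
    rw [Finset.prod_congr rfl fun k _ => sum_admissible hl i k (mem_support_content i k)]
    rw [prod_blocks i (fun b => blockForm t S T b)
      (fun b => blockForm t S T b - MvPolynomial.C t * MvPolynomial.X b)]
    refine Finset.prod_congr rfl fun b hb => ?_
    rw [blockFactor, if_neg (Finsupp.mem_support_iff.mp hb), if_pos hb]
  change MvPolynomial.coeff (content i) _ = _
  rw [h1, Finset.prod_univ_sum, MvPolynomial.coeff_sum, Finset.sum_filter]
  refine Finset.sum_congr rfl fun w _ => ?_
  have h2 : ∏ k, MvPolynomial.C (classWeight l (w k).2) *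
      (MvPolynomial.X (w k).1 : MvPolynomial ℕ+ A) =
        MvPolynomial.monomial (content fun k => (w k).1) (classProd l w) := by
    rw [content, classProd, MvPolynomial.monomial_sum_prod]
    refine Finset.prod_congr rfl fun k _ => ?_
    rw [MvPolynomial.C_mul_X_eq_monomial]
  rw [h2, MvPolynomial.coeff_monomial]

/-- The weight of a word; it is the weight of the corresponding pair, see `pairWeight_eq`. -/
def wordProd (l : ℕ) (w : Σ n : ℕ, Fin n → ℕ+ × ℕ) : A :=
  ∏ k, (classWeight l (w.2 k).2 * (x (w.2 k).1 * z))

theorem wordProd_eq (l : ℕ) (w : Σ n : ℕ, Fin n → ℕ+ × ℕ) :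
    wordProd l w = classProd l w.2 *
      (content fun k => (w.2 k).1).prod fun b k => (x b * z) ^ k := by
  rw [wordProd, Finset.prod_mul_distrib, classProd, content,
    ← Finsupp.prod_finsetSum_index (fun _ => pow_zero _) (fun _ _ _ => pow_add _ _ _)]
  congr 1
  refine Finset.prod_congr rfl fun k _ => ?_
  exact ((Finsupp.prod_single_index (h := fun b k => (x b * z) ^ k) (pow_zero _)).trans
    (pow_one _)).symm

theorem pairWeight_eq {l : ℕ} (v : CompatiblePair l) :
    pairWeight (fun (m : Fin l) _ => colorWeight m) t (fun m => colorWeight m) v =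
      wordProd l (pairWord v) := by
  obtain ⟨n, ⟨⟨π, i⟩, h⟩⟩ := v
  refine Eq.trans ?_ (Equiv.prod_comp π.1 _)
  refine Finset.prod_congr rfl fun j _ => ?_
  have h1 := (π.2 j).2
  simp only [pairWord, Equiv.symm_apply_apply]
  congr 1
  unfold letterWeight classWeight zone
  have h2 : l - (l - (π.2 j : ℕ)) = π.2 j := by omega
  have h3 : l - (π.2 j : ℕ) ≠ 0 := by omega
  by_cases hf : π.1 j = j
  · simp only [hf, not_isExc_of_fixed hf, if_true, if_false, h2, h3]
  · by_cases he : IsExc π j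
    · simp only [hf, he, if_true, if_false]
    · simp only [hf, he, if_false, h2, h3]

/-- The generating function of the compatible pairs with content `c`; `f` is the weight of words,
extended by zero to the words that do not come from a compatible pair. -/
theorem hasSum_fiber {l : ℕ} (hl : 0 < l) (c : ℕ+ →₀ ℕ) (f : (Σ n : ℕ, Fin n → ℕ+ × ℕ) → A)
    (hf : ∀ v : CompatiblePair l, f (pairWord v) = wordProd l (pairWord v))
    (hf' : ∀ w ∉ Set.range (pairWord (l := l)), f w = 0) :
    HasSum (fun w : {w : Σ n : ℕ, Fin n → ℕ+ × ℕ // content (fun k => (w.2 k).1) = c} => f w)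
      (circuitSeriesAll t (∑ m ∈ Finset.Ico 1 l, s m) t c * c.prod fun b k => (x b * z) ^ k) := by
  classical
  obtain ⟨n, i, hi, rfl⟩ := exists_antitone_content c
  set W := (Fintype.piFinset fun k => ((content i).support ×ˢ Finset.range (l + 1)).filter
    (IsAdmissible l i k)).filter fun w => content (fun k => (w k).1) = content i with hW
  have h1 : ∀ w ∈ W, f ⟨n, w⟩ =
      classProd l w * (content i).prod fun b k => (x b * z) ^ k := by
    intro w hw
    rw [hW, Finset.mem_filter, Fintype.mem_piFinset] at hw
    obtain ⟨v, hv⟩ := exists_pairWord_eq hl hi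
      (fun k => (Finset.mem_filter.mp (hw.1 k)).2) hw.2
    rw [← hv, hf, hv, wordProd_eq]
    simp only [hw.2]
  have h2 : circuitSeriesAll t (∑ m ∈ Finset.Ico 1 l, s m) t (content i) *
      ((content i).prod fun b k => (x b * z) ^ k) =
        ∑ w ∈ W.map ⟨Sigma.mk n, sigma_mk_injective⟩,
          {w : Σ n : ℕ, Fin n → ℕ+ × ℕ |
            content (fun k => (w.2 k).1) = content i}.indicator f w := by
    rw [circuitSeriesAll_content hl, Finset.sum_mul, Finset.sum_map]
    refine Finset.sum_congr rfl fun w hw => ?_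
    rw [← h1 w hw, Set.indicator_of_mem]
    · rfl
    · exact (Finset.mem_filter.mp hw).2
  rw [h2]
  refine (hasSum_subtype_iff_indicator (f := f)).mpr (hasSum_sum_of_ne_finset_zero ?_)
  rintro w hw
  by_contra hne
  obtain ⟨hmem, hne⟩ := Set.indicator_apply_ne_zero.mp hne
  obtain ⟨v, rfl⟩ : w ∈ Set.range (pairWord (l := l)) := by_contra fun hc => hne (hf' w hc)
  obtain ⟨n', ⟨⟨π, i'⟩, h⟩⟩ := v
  have hc : content i' = content i :=
    (content_comp_perm i' π.1.symm).symm.trans hmem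
  obtain rfl : n' = n := by rw [← degree_content i', hc, degree_content]
  obtain rfl : i' = i := eq_of_antitone_of_content_eq (antitone_of_precedes h) hi hc
  refine hw (Finset.mem_map.mpr ⟨_, Finset.mem_filter.mpr ⟨?_, hmem⟩, rfl⟩)
  refine Fintype.mem_piFinset.mpr fun k => ?_
  have h3 := IsCompatible.isAdmissible h k
  refine Finset.mem_filter.mpr ⟨Finset.mem_product.mpr ⟨mem_support_content i' _, ?_⟩, h3⟩
  exact Finset.mem_range.mpr (Nat.lt_succ_of_le h3.1)

/-! ### Evaluation of the content series -/

theorem hasEval_xz : MvPowerSeries.HasEval fun b : ℕ+ => x b * z where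
  hpow b := MvPowerSeries.LinearTopology.isTopologicallyNilpotent_of_constantCoeff
    (by rw [map_mul, MvPowerSeries.constantCoeff_X, zero_mul]; exact IsTopologicallyNilpotent.zero)
  tendsto_zero := by
    rw [tendsto_iff_eventually_coeff]
    intro d
    have hinj : Function.Injective Var.x := fun a b hab => by cases hab; rfl
    rw [Filter.eventually_cofinite]
    refine (d.support.finite_toSet.preimage hinj.injOn).subset fun b hb => ?_
    by_contra hc
    refine hb ?_
    rw [map_zero]
    refine coeff_eq_zero_of_X_pow_dvd (v := Var.x b) (k := 1) ?_ ?_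
    · rw [pow_one]
      exact dvd_mul_right _ _
    · simpa using hc

/-- The substitution `X b ↦ x b * z`. -/
def theta : MvPowerSeries ℕ+ A →ₐ[A] A := MvPowerSeries.aeval hasEval_xz

theorem continuous_theta : Continuous theta := MvPowerSeries.continuous_aeval _

theorem theta_monomial (b : ℕ+) (a : A) :
    theta (MvPowerSeries.monomial (Finsupp.single b 1) a) = a * (x b * z) := by
  have h : MvPowerSeries.monomial (Finsupp.single b 1) a =
      ((MvPolynomial.monomial (Finsupp.single b 1) a : MvPolynomial ℕ+ A) : MvPowerSeries ℕ+ A) :=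
    (MvPolynomial.coe_monomial _ _).symm
  rw [theta, h, MvPowerSeries.aeval_coe, MvPolynomial.aeval_monomial]
  simp

theorem theta_C (a : A) : theta (MvPowerSeries.C a) = a := theta.commutes a

/-- The reduction of the first letters of all blocks amounts to the factor `∏_b (1 - e x_b z)`. -/
theorem theta_circuitSeriesAll (u S e : A) :
    theta (circuitSeriesAll u S e) = Ez (-e) * theta (circuitSeries u S e ∅) := by
  have h1 : Tendsto (fun U : Finset ℕ+ => theta (circuitSeries u S e U)) atTop
      (𝓝 (theta (circuitSeriesAll u S e))) := by
    refine (continuous_theta.tendsto _).comp ?_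
    rw [MvPowerSeries.WithPiTopology.tendsto_iff_coeff_tendsto]
    intro c
    refine tendsto_nhds_of_eventually_eq ?_
    filter_upwards [eventually_ge_atTop c.support] with U hU
    exact circuitSeries_of_subset u S e hU
  refine tendsto_nhds_unique h1 ?_
  have h2 := (tendsto_finsetProd_of_hasProd (hasProd_Ez (-e))).mul_const
    (theta (circuitSeries u S e ∅))
  refine h2.congr fun U => ?_
  have h3 : ∀ b ∈ U, 1 + -e * (x b * z) =
      theta (1 - MvPowerSeries.monomial (Finsupp.single b 1) e) := fun b _ => by
    rw [map_sub, map_one, theta_monomial]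
    ring
  rw [← prod_one_sub_mul_circuitSeries u S e U, map_mul, map_prod, Finset.prod_congr rfl h3]

instance : IsDomain A := NoZeroDivisors.to_isDomain _

/-- Both `circuitSeriesAll u S 1` and `circuitSeriesAll u S u` are multiples of the same series, so
that the linear relation between them determines them. -/
theorem theta_relation (u S : A) :
    theta (circuitSeriesAll u S u) * ((1 + S) * Ez (-1) - (u + S) * Ez (-u)) =
      (1 - u) * Ez (-u) := by
  have h1 := congrArg theta (circuitSeriesAll_relation (ι := ℕ+) u S)
  rw [map_sub, map_mul, map_mul, theta_C, theta_C, theta_C] at h1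
  have h2 := theta_circuitSeriesAll u S 1
  have h3 := theta_circuitSeriesAll u S u
  rw [circuitSeries_empty u S 1 u] at h2
  linear_combination Ez (-u) * h1 - (1 + S) * Ez (-u) * h2 + (1 + S) * Ez (-1) * h3

theorem theta_mul_denom (l : ℕ) :
    theta (circuitSeriesAll t (∑ m ∈ Finset.Ico 1 l, s m) t) * denom l Hz = (1 - t) * Hz 1 := by
  have h1 := theta_relation t (∑ m ∈ Finset.Ico 1 l, s m)
  have h2 := Ez_neg_mul_Hz 1
  have h3 := Ez_neg_mul_Hz t
  unfold denom
  set S := ∑ m ∈ Finset.Ico 1 l, s m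
  set L := theta (circuitSeriesAll t S t)
  linear_combination Hz 1 * Hz t * h1 - L * (1 + S) * Hz t * h2 +
    L * (t + S) * Hz 1 * h3 + (1 - t) * Hz 1 * h3

/-- Compatible pairs in which fixed points are not distinguished from other letters. -/
theorem pairSum_eq_theta {l : ℕ} (hl : 0 < l) :
    pairSum (fun (m : Fin l) _ => colorWeight m) t (fun m => colorWeight m) =
      theta (circuitSeriesAll t (∑ m ∈ Finset.Ico 1 l, s m) t) := by
  classical
  let f : (Σ n : ℕ, Fin n → ℕ+ × ℕ) → A := fun w =>
    if w ∈ Set.range (pairWord (l := l)) then wordProd l w else 0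
  have hf : ∀ v : CompatiblePair l, f (pairWord v) = wordProd l (pairWord v) := fun v =>
    if_pos ⟨v, rfl⟩
  have hf' : ∀ w ∉ Set.range (pairWord (l := l)), f w = 0 := fun w hw => if_neg hw
  have h1 : HasSum f
      (pairSum (fun (m : Fin l) _ => colorWeight m) t (fun m => colorWeight m)) := by
    rw [← pairWord_injective.hasSum_iff hf']
    refine hasSum_of_forall_eq (summable_pairWeight _ _ _).hasSum fun v => ?_
    rw [pairWeight_eq, Function.comp, hf]
  have h2 := ((Equiv.sigmaFiberEquiv fun w : Σ n : ℕ, Fin n → ℕ+ × ℕ =>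
    content fun k => (w.2 k).1).hasSum_iff.mpr h1).sigma fun c => hasSum_fiber hl c f hf hf'
  exact h2.unique (MvPowerSeries.hasSum_aeval hasEval_xz _)

/-- The comparison with the pairs whose fixed points have the weight of other letters. -/
theorem pairSum_mul_denom {l : ℕ} (hl : 0 < l) :
    pairSum (fun (m : Fin l) _ => r m * colorWeight m) t (fun m => colorWeight m) *
      denom l Hz = numer l Hz Ez := by
  have h1 := prod_Ez_mul_pairSum (fun m : Fin l => r m * colorWeight m) t fun m => colorWeight m
  have h2 := prod_Ez_mul_pairSum (fun m : Fin l => colorWeight m) t fun m => colorWeight m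
  have h3 := theta_mul_denom l
  rw [← pairSum_eq_theta hl] at h3
  rw [← h2] at h1
  have hsplit : ∀ g : ℕ → A, ∏ m : Fin l, g m = g 0 * ∏ m ∈ Finset.Ico 1 l, g m := fun g => by
    rw [← Finset.prod_range, Finset.range_eq_Ico, Finset.prod_eq_prod_Ico_succ_bot hl]
  rw [hsplit fun m => Ez (-(r m * colorWeight m)), hsplit fun m => Ez (-colorWeight m)] at h1
  have hc : ∀ g : A → ℕ → A, ∏ m ∈ Finset.Ico 1 l, g (colorWeight m) m =
      ∏ m ∈ Finset.Ico 1 l, g (s m) m := fun g => Finset.prod_congr rfl fun m hm => by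
    rw [colorWeight, if_neg (Nat.one_le_iff_ne_zero.mp (Finset.mem_Ico.mp hm).1)]
  have h0 : colorWeight 0 = 1 := if_pos rfl
  rw [hc fun a m => Ez (-(r m * a)), hc fun a _ => Ez (-a), h0, mul_one] at h1
  have hinv : (∏ m ∈ Finset.Ico 1 l, Ez (-(r m * s m))) * ∏ m ∈ Finset.Ico 1 l, Hz (r m * s m) =
      1 := by
    rw [← Finset.prod_mul_distrib]
    exact Finset.prod_eq_one fun m _ => Ez_neg_mul_Hz _
  have h4 := Ez_neg_mul_Hz (r 0)
  have h5 := Ez_neg_mul_Hz 1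
  rw [numer, Finset.prod_mul_distrib]
  set L := pairSum (fun (m : Fin l) _ => r m * colorWeight m) t (fun m => colorWeight m)
  set L1 := pairSum (fun (m : Fin l) _ => colorWeight m) t (fun m => colorWeight m)
  set P := ∏ m ∈ Finset.Ico 1 l, Ez (-(r m * s m))
  set P' := ∏ m ∈ Finset.Ico 1 l, Hz (r m * s m)
  set E := ∏ m ∈ Finset.Ico 1 l, Ez (-s m)
  set D := denom l Hz
  calc L * D = (Ez (-r 0) * Hz (r 0)) * (P * P') * (L * D) := by rw [h4, hinv]; ring
    _ = Hz (r 0) * P' * D * (Ez (-r 0) * P * L) := by ring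
    _ = Hz (r 0) * P' * E * Ez (-1) * (L1 * D) := by rw [h1]; ring
    _ = Hz (r 0) * P' * E * (1 - t) * (Ez (-1) * Hz 1) := by rw [h3]; ring
    _ = _ := by rw [h5]; ring

end

end ColoredEulerian

theorem mainTheorem12 (l : ℕ) (hl : 0 < l) :
    -- the limit of the generating functions of words over `[0, N]`
    ((∀ N : ℕ, Summable fun w : List (Fin (N + 1)) => ColoredEulerian.wordWeight l w) ∧
      IsUnit (ColoredEulerian.denom l ColoredEulerian.HY) ∧
      Tendsto (fun N : ℕ => ∑' w : List (Fin (N + 1)), ColoredEulerian.wordWeight l w) atTop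
        (𝓝 (ColoredEulerian.numer l ColoredEulerian.HY ColoredEulerian.EY *
          Ring.inverse (ColoredEulerian.denom l ColoredEulerian.HY)))) ∧
    -- the generating function of the fixed point colored Eulerian quasisymmetric functions
    (IsUnit (ColoredEulerian.denom l ColoredEulerian.Hz) ∧
      HasSum
        (fun p : ℕ × ℕ × (Fin l → ℕ) × (Fin (l - 1) → ℕ) =>
          ColoredEulerian.Q l p.1 p.2.1 p.2.2.1 p.2.2.2 *
            ColoredEulerian.z ^ p.1 * ColoredEulerian.t ^ p.2.1 *
            (∏ m : Fin l, ColoredEulerian.r m ^ p.2.2.1 m) *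
            ∏ m : Fin (l - 1), ColoredEulerian.s (m + 1) ^ p.2.2.2 m)
        (ColoredEulerian.numer l ColoredEulerian.Hz ColoredEulerian.Ez *
          Ring.inverse (ColoredEulerian.denom l ColoredEulerian.Hz))) := by
  refine ⟨⟨fun N => (ColoredEulerian.hasSum_wordWeight N).summable, ?_, ?_⟩, ?_, ?_⟩
  · exact ColoredEulerian.isUnit_of_constantCoeff
      (ColoredEulerian.constantCoeff_denom ColoredEulerian.constantCoeff_HY)
  · refine ((ColoredEulerian.tendsto_wordSum hl).comp (tendsto_add_atTop_nat 1)).congr fun N => ?_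
    exact (ColoredEulerian.hasSum_wordWeight N).tsum_eq.symm
  · exact ColoredEulerian.isUnit_of_constantCoeff
      (ColoredEulerian.constantCoeff_denom ColoredEulerian.constantCoeff_Hz)
  · have h1 := Ring.mul_inverse_cancel _ (ColoredEulerian.isUnit_of_constantCoeff
      (ColoredEulerian.constantCoeff_denom (l := l) ColoredEulerian.constantCoeff_Hz))
    rw [← ColoredEulerian.pairSum_mul_denom hl, mul_assoc, h1, mul_one]
    exact ColoredEulerian.hasSum_Q
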